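/- Let $\beta, M \in \mathbb{R}$ with $M \neq 0$. Consider on $\mathbb{R}^3$ the Rikitake vector field $$X^\beta(x,y,z) = (yz+\beta y)\,\partial_x + (xz-\beta x)\,\partial_y - xy\,\partial_z ,$$ the function $C(x,y,z)=\tfrac12(x^2+y^2)+z^2$, and the Poisson bracket on $\mathbb{R}^3$ defined by $\{f,g\}\,dx\wedge dy\wedge dz = dC\wedge df\wedge dg$. The symplectic leaf of this Poisson structure through $p=(0,0,M)$ is the ellipsoid $\Sigma_{M^2}=\{(x,y,z)\in\mathbb{R}^3 : C(x,y,z)=M^2\}$ (a leaf consists of the points that can be joined by paths made of finitely many integral curves of Hamiltonian vector fields). The field $X^\beta$ is tangent to $\Sigma_{M^2}$, its restriction $X^\beta|_{\Sigma_{M^2}}$ is complete, and $p$ is an equilibrium of it. Let $F_t$ be the flow of $X^\beta|_{\Sigma_{M^2}}$. The linearization of $X^\beta|_{\Sigma_{M^2}}$ at $p$ is the linear map $\mathfrak{L}\colon T_p\Sigma_{M^2}\to T_p\Sigma_{M^2}$, $\mathfrak{L}v=\frac{d}{dt}\big|_{t=0}\,\mathrm{D}F_t(p)v$. The equilibrium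 $p$ is Lyapunov stable on the leaf if every open neighborhood $U\subseteq\Sigma_{M^2}$ of $p$ contains an open neighborhood $V$ of $p$ with $F_t(V)\subseteq U$ for all $t\ge 0$, and unstable on the leaf otherwise. Then: (a) The linearization exists, and its characteristic polynomial is $\mu^2+(\beta^2-M^2)$. (b) If $|\beta|<|M|$, then $p$ is an unstable equilibrium of $X^\beta|_{\Sigma_{M^2}}$. (c) If $|\beta|>|M|$, then $p$ is a Lyapunov stable equilibrium of $X^\beta|_{\Sigma_{M^2}}$. (d) If $|\beta|>|M|$, then there exist $\varepsilon_0>0$ and a one-parameter family $\{\gamma_\varepsilon\}_{0<\varepsilon\le\varepsilon_0}$ of pairwise distinct periodic orbits of $X^\beta|_{\Sigma_{M^2}}$ (hence of $X^\beta$), $\gamma_\varepsilon\subset\Sigma_{M^2}$ being the orbit of a point that depends continuously on $\varepsilon$, such that the $\gamma_\varepsilon$ shrink to $p$ as $\varepsilon\to0$ (every neighborhood of $p$ in $\Sigma_{M^2}$ contains $\gamma_\varepsilon$ for all sufficiently small $\varepsilon$), and the minimal period $T_\varepsilon>0$ of $\gamma_\varepsilon$ satisfies $T_\varepsilon\to 2\pi/\sqrt{\beta^2-M^2}$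 as $\varepsilon\to0$. Moreover, the set $\{p\}\cup\bigcup_{0<\varepsilon<\varepsilon_0}\gamma_\varepsilon$ is the connected component of $\Sigma_{M^2}\setminus\gamma_{\varepsilon_0}$ that contains $p$. -/

import Mathlib

open Set Filter Topology
open scoped ContDiff

/-- Three-dimensional Euclidean space, with coordinates `p 0 = x`, `p 1 = y`, `p 2 = z`. -/
abbrev E3 : Type := EuclideanSpace ℝ (Fin 3)

noncomputable section

/-- The Rikitake vector field: `x' = y z + β y`, `y' = x z - β x`, `z' = - x y`. -/
def rikitake (β : ℝ) (p : E3) : E3 :=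
  !₂[p 1 * p 2 + β * p 1, p 0 * p 2 - β * p 0, -(p 0 * p 1)]

/-- The function `C(x, y, z) = (x² + y²) / 2 + z²`. -/
def casimir (p : E3) : ℝ := (p 0 ^ 2 + p 1 ^ 2) / 2 + p 2 ^ 2

/-- The level set `Σ_r = {C = r}`. -/
def ellipsoid (r : ℝ) : Set E3 := {p | casimir p = r}

/-- The row vector of the partial derivatives of `f` at `p`. -/
def partials (f : E3 → ℝ) (p : E3) : Fin 3 → ℝ :=
  fun i => fderiv ℝ f p (EuclideanSpace.single i 1)

/-- The Poisson bracket of `ℝ³` given by `{f, g} dx ∧ dy ∧ dz = dC ∧ df ∧ dg`. -/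
def poissonBracket (f g : E3 → ℝ) (p : E3) : ℝ :=
  Matrix.det !![partials casimir p 0, partials casimir p 1, partials casimir p 2;
    partials f p 0, partials f p 1, partials f p 2;
    partials g p 0, partials g p 1, partials g p 2]

/-- The Hamiltonian vector field of `f`, with components `{x, f}`, `{y, f}`, `{z, f}`. -/
def hamiltonianField (f : E3 → ℝ) (p : E3) : E3 :=
  WithLp.toLp 2 (fun i => poissonBracket (fun q => q i) f p)

/-- `q` is reached from `p` along an integral curve of a smooth Hamiltonian vector field. -/
def HamiltonianStep (p q : E3) : Prop :=
  ∃ f : E3 → ℝ, ContDiff ℝ ∞ f ∧ ∃ (γ : ℝ → E3) (s t : ℝ), s ≤ t ∧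
    IsIntegralCurveOn γ (fun _ => hamiltonianField f) (Icc s t) ∧ γ s = p ∧ γ t = q

/-- The symplectic leaf through `p`: the points that can be joined with `p` by a path made of
finitely many integral curves of Hamiltonian vector fields. -/
def symplecticLeaf (p : E3) : Set E3 := {q | Relation.ReflTransGen HamiltonianStep p q}

/-- The tangent space of the level set of `C` through `p`, as the kernel of `dC(p)`. -/
abbrev leafTangent (p : E3) : Submodule ℝ E3 :=
  LinearMap.ker (fderiv ℝ casimir p : E3 →ₗ[ℝ] ℝ)

theorem hasFDerivAt_casimir (p : E3) :
    HasFDerivAt casimir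
      (p 0 • (EuclideanSpace.proj 0 : E3 →L[ℝ] ℝ) + p 1 • (EuclideanSpace.proj 1 : E3 →L[ℝ] ℝ)
        + (2 * p 2) • (EuclideanSpace.proj 2 : E3 →L[ℝ] ℝ)) p := by
  have h : ∀ i : Fin 3, HasFDerivAt (fun q : E3 => q i) (EuclideanSpace.proj i : E3 →L[ℝ] ℝ) p :=
    fun i => (EuclideanSpace.proj i : E3 →L[ℝ] ℝ).hasFDerivAt
  have h2 := ((((h 0).pow 2).add ((h 1).pow 2)).mul_const (2⁻¹ : ℝ)).add ((h 2).pow 2)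
  refine (h2.congr_fderiv ?_).congr_of_eventuallyEq ?_
  · ext v
    simp
    ring
  · exact Eventually.of_forall fun q => by simp [casimir, div_eq_mul_inv]

theorem rikitake_mem_leafTangent (β : ℝ) (p : E3) : rikitake β p ∈ leafTangent p := by
  rw [LinearMap.mem_ker]
  simp [(hasFDerivAt_casimir p).fderiv, rikitake]
  ring

/-- The restriction of the Rikitake field to the leaf `Σ_r`, a field of tangent vectors. -/
def leafField (β : ℝ) {r : ℝ} (p : ellipsoid r) : leafTangent (p : E3) :=
  ⟨rikitake β p, rikitake_mem_leafTangent β p⟩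

/-- The equilibrium point `(0, 0, M)`, as a point of the leaf `Σ_{M²}`. -/
def pole (M : ℝ) : ellipsoid (M ^ 2) := ⟨!₂[0, 0, M], by simp [ellipsoid, casimir]⟩

/-- `φ` is the (complete) flow of the restricted vector field on `Σ_r`: each `t ↦ φ t p` is the
integral curve in `Σ_r` that starts at `p`. -/
structure IsLeafFlow (β : ℝ) {r : ℝ} (φ : ℝ → ellipsoid r → ellipsoid r) : Prop where
  map_zero : ∀ p, φ 0 p = p
  hasDerivAt : ∀ p t, HasDerivAt (fun s => (φ s p : E3)) (leafField β (φ t p) : E3) t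

/-- Lyapunov stability of the point `p` under the flow `φ` on a leaf with its subspace topology. -/
def IsLyapunovStable {r : ℝ} (φ : ℝ → ellipsoid r → ellipsoid r) (p : ellipsoid r) : Prop :=
  ∀ U : Set (ellipsoid r), IsOpen U → p ∈ U →
    ∃ V ⊆ U, IsOpen V ∧ p ∈ V ∧ ∀ q ∈ V, ∀ t : ℝ, 0 ≤ t → φ t q ∈ U

/-- `D` is the differential at `p` of the map `f` of the surface `Σ_r` to itself (its values are
tangent vectors at `f p`, here viewed in `ℝ³`). -/
def HasLeafDerivAt {r : ℝ} (f : ellipsoid r → ellipsoid r) (p : ellipsoid r)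
    (D : leafTangent (p : E3) →L[ℝ] E3) : Prop :=
  (fun q : ellipsoid r => (f q : E3) - (f p : E3) -
      D ((leafTangent (p : E3)).orthogonalProjectionOnto ((q : E3) - (p : E3))))
    =o[𝓝 p] (fun q : ellipsoid r => (q : E3) - (p : E3))

/-- `L` is the linearization at the equilibrium `p` of the vector field on `Σ_r` with flow `φ`:
`L v = d/dt (Dφ_t(p) v)` at `t = 0`, for tangent vectors `v` at `p`. -/
def IsLinearization {r : ℝ} (φ : ℝ → ellipsoid r → ellipsoid r) (p : ellipsoid r)
    (L : leafTangent (p : E3) →ₗ[ℝ] leafTangent (p : E3)) : Prop :=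
  ∃ D : ℝ → leafTangent (p : E3) →L[ℝ] E3,
    (∀ t, HasLeafDerivAt (φ t) p (D t)) ∧
    ∀ v, HasDerivAt (fun t => D t v) (L v : E3) 0

/-- The orbit of `p` under `φ`. -/
def leafOrbit {r : ℝ} (φ : ℝ → ellipsoid r → ellipsoid r) (p : ellipsoid r) : Set (ellipsoid r) :=
  range fun t => φ t p

/-- The orbit of `p` under `φ` is periodic, and `T` is its (least positive) period. In particular
`p` is not an equilibrium. -/
def IsOrbitPeriod {r : ℝ} (φ : ℝ → ellipsoid r → ellipsoid r) (p : ellipsoid r) (T : ℝ) : Prop :=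
  IsLeast {t : ℝ | 0 < t ∧ φ t p = p} T

end

/-! The field is tangent to every level set of `C`. The proof rests on that and on a second first
integral, `(x² - y²) / 2 + 2 β z`. Dividing the field by a multiple of `1 + C` makes it bounded
without changing it on the chosen ellipsoid, and this gives the flow (`exists_isLeafFlow`). The leaf
is the whole ellipsoid because the Hamiltonian flows of `x` and `z` already reach every point from
the pole.

Linearization: on the ellipsoid the field minus its linear part at the pole is quadratic in the
distance to the pole. Variation of constants then gives the differential of the flow there as `exp
(t A)`, where `A` has the matrix with rows `(0, M + β)` and `(M - β, 0)`. Meridians show that the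
differential is unique.

Instability for `|β| < |M|`: with `σ` the sign of `M`, the product `σ x y` does not decrease while
`σ z > |β|`, and it is the speed at which `σ z` falls. An orbit starting with `σ x y > 0` must
therefore leave a fixed neighborhood of the pole.

For `|β| > |M|` write `M = σ m`, `β = τ B` and `Z = σ z`. A suitable affine function `E` of the
second integral (`poleEnergy`) satisfies `E ≥ 2 (B - m) (m - Z)` on the ellipsoid, so its sublevel
sets shrink to the pole, and stability follows. A rescaled projection to the `(x, y)`-plane turns
the linear flow into a rotation of frequency `ω = √(β² - M²)`. Along the true flow the angular
velocity lies within the factors `1 ± δ` of `ω`, where `δ` is proportional to `E`. Low energy levels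
meet each ray in at most one point, so each is a single periodic orbit with period between `2π / (ω
(1 + δ))` and `2π / (ω (1 - δ))` (`exists_period`). Parametrizing the levels by a meridian gives the
family, and the sublevel set is the required component. -/

open Set Filter Topology
open scoped ContDiff
-- Existence of the flow on the ellipsoid
open scoped NNReal Manifold in
/-- A bounded `C¹` vector field on a finite-dimensional space is complete. -/
theorem exists_isIntegralCurve_of_contDiff_of_bounded {E : Type*} [NormedAddCommGroup E]
    [NormedSpace ℝ E] [FiniteDimensional ℝ E] {V : E → E} (hV : ContDiff ℝ 1 V) {L : ℝ≥0}
    (hL : ∀ x, ‖V x‖ ≤ L) (x : E) :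
    ∃ γ : ℝ → E, γ 0 = x ∧ ∀ t, HasDerivAt γ (V (γ t)) t := by
  have : CompleteSpace E := FiniteDimensional.complete ℝ E
  have : ProperSpace E := FiniteDimensional.proper ℝ E
  have key : ∀ a : ℝ, ∃ γ : ℝ → E, γ 0 = x ∧
      IsMIntegralCurveOn (I := 𝓘(ℝ, E)) γ V (Ioo (-a) a) := by
    intro a
    rcases le_or_gt a 0 with ha | ha
    · exact ⟨fun _ => x, rfl, by rw [Ioo_eq_empty (by linarith)]; exact fun t ht => ht.elim⟩
    -- At speed at most `L` a solution stays within distance `L a` of `x` up to time `a`, so a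
    -- Lipschitz constant on this compact ball suffices for the whole interval.
    obtain ⟨K, hK⟩ := (hV.locallyLipschitz.locallyLipschitzOn
      (s := Metric.closedBall x ((L * a.toNNReal : ℝ≥0) : ℝ))).exists_lipschitzOnWith_of_compact
      (isCompact_closedBall _ _)
    have hP : IsPicardLindelof (fun _ => V) (tmin := -a) (tmax := a) ⟨0, by simp [ha.le]⟩ x
        (L * a.toNNReal) 0 L K :=
      IsPicardLindelof.of_time_independent (fun y _ => hL y) hK (by simp [ha.le])
    obtain ⟨γ, h0, hγ⟩ := hP.exists_eq_forall_mem_Icc_hasDerivWithinAt₀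
    refine ⟨γ, h0, fun t ht => ?_⟩
    have h := (hγ t (Ioo_subset_Icc_self ht)).mono Ioo_subset_Icc_self
    exact h.hasFDerivWithinAt.hasMFDerivWithinAt
  obtain ⟨γ, h0, hγ⟩ := (exists_isMIntegralCurve_iff_exists_isMIntegralCurveOn_Ioo
    (I := 𝓘(ℝ, E)) (v := V) (contMDiff_vectorSpace_iff_contDiff.2 hV) x).2 key
  refine ⟨γ, h0, fun t => ?_⟩
  have h : HasFDerivAt γ ((1 : ℝ →L[ℝ] ℝ).smulRight (V (γ t))) t := (hγ t).hasFDerivAt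
  simpa using h.hasDerivAt

theorem E3.norm_sq_eq (v : E3) : ‖v‖ ^ 2 = v 0 ^ 2 + v 1 ^ 2 + v 2 ^ 2 := by
  rw [EuclideanSpace.norm_sq_eq, Fin.sum_univ_three]
  simp

theorem HasDerivAt.E3_apply {γ : ℝ → E3} {v : E3} {t : ℝ} (h : HasDerivAt γ v t) (i : Fin 3) :
    HasDerivAt (fun s => γ s i) (v i) t := by
  exact (EuclideanSpace.proj i : E3 →L[ℝ] ℝ).hasFDerivAt.comp_hasDerivAt t h

theorem hasDerivAt_E3 {γ : ℝ → E3} {v : E3} {t : ℝ}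
    (h : ∀ i, HasDerivAt (fun s => γ s i) (v i) t) : HasDerivAt γ v t := by
  let e := (PiLp.continuousLinearEquiv 2 ℝ (fun _ : Fin 3 => ℝ)).symm.toContinuousLinearMap
  exact e.hasFDerivAt.comp_hasDerivAt t (hasDerivAt_pi.2 h)

theorem contDiff_rikitake (β : ℝ) : ContDiff ℝ ∞ (rikitake β) := by
  rw [contDiff_euclidean]
  intro i
  fin_cases i <;> simp [rikitake] <;> fun_prop

theorem contDiff_casimir : ContDiff ℝ ∞ casimir := by
  unfold casimir
  fun_prop

theorem casimir_nonneg (p : E3) : 0 ≤ casimir p := by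
  unfold casimir; positivity

/-- The field is quadratic and so is `C`; this bound is what makes the field divided by `1 + C`
bounded. -/
theorem norm_rikitake_le (β : ℝ) (p : E3) :
    ‖rikitake β p‖ ≤ 3 * (1 + |β|) * (1 + casimir p) := by
  have hβ := abs_nonneg β
  have hC := casimir_nonneg p
  have h1 : |p 1 * p 2 + β * p 1| ≤ (1 + |β|) * (1 + casimir p) := by
    refine (abs_add_le _ _).trans ?_
    have e1 : |p 1 * p 2| ≤ casimir p := by
      rw [abs_le]; unfold casimir; constructor <;>
        nlinarith [sq_nonneg (p 1 + p 2), sq_nonneg (p 1 - p 2), sq_nonneg (p 2), sq_nonneg (p 0)]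
    have e2 : |p 1| ≤ 1 + casimir p := by
      rw [abs_le]; unfold casimir; constructor <;>
        nlinarith [sq_nonneg (p 1 + 1), sq_nonneg (p 1 - 1), sq_nonneg (p 2)]
    rw [abs_mul β]
    nlinarith [mul_le_mul_of_nonneg_left e2 hβ]
  have h2 : |p 0 * p 2 - β * p 0| ≤ (1 + |β|) * (1 + casimir p) := by
    refine (abs_sub _ _).trans ?_
    have e1 : |p 0 * p 2| ≤ casimir p := by
      rw [abs_le]; unfold casimir; constructor <;>
        nlinarith [sq_nonneg (p 0 + p 2), sq_nonneg (p 0 - p 2), sq_nonneg (p 2), sq_nonneg (p 1)]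
    have e2 : |p 0| ≤ 1 + casimir p := by
      rw [abs_le]; unfold casimir; constructor <;>
        nlinarith [sq_nonneg (p 0 + 1), sq_nonneg (p 0 - 1), sq_nonneg (p 2), sq_nonneg (p 1)]
    rw [abs_mul β]
    nlinarith [mul_le_mul_of_nonneg_left e2 hβ]
  have h3 : |-(p 0 * p 1)| ≤ (1 + |β|) * (1 + casimir p) := by
    have e1 : |-(p 0 * p 1)| ≤ casimir p := by
      rw [abs_le]; unfold casimir; constructor <;>
        nlinarith [sq_nonneg (p 0 + p 1), sq_nonneg (p 0 - p 1), sq_nonneg (p 2)]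
    nlinarith [mul_nonneg hβ hC]
  have hS : 0 ≤ (1 + |β|) * (1 + casimir p) := by positivity
  rw [mul_assoc]
  refine abs_le_of_sq_le_sq' ?_ (by positivity) |>.2
  rw [E3.norm_sq_eq]
  have := sq_le_sq' (abs_le.1 h1).1 (abs_le.1 h1).2
  have := sq_le_sq' (abs_le.1 h2).1 (abs_le.1 h2).2
  have := sq_le_sq' (abs_le.1 h3).1 (abs_le.1 h3).2
  simp only [rikitake]
  simp
  nlinarith [sq_nonneg ((1 + |β|) * (1 + casimir p))]

theorem hasDerivAt_casimir_comp {γ : ℝ → E3} {v : E3} {t : ℝ} (h : HasDerivAt γ v t) :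
    HasDerivAt (fun s => casimir (γ s)) (γ t 0 * v 0 + γ t 1 * v 1 + 2 * γ t 2 * v 2) t := by
  refine HasDerivAt.congr_deriv ((hasFDerivAt_casimir (γ t)).comp_hasDerivAt t h) ?_
  simp

theorem exists_isLeafFlow (β r : ℝ) :
    ∃ φ : ℝ → ellipsoid r → ellipsoid r, IsLeafFlow β φ := by
  have key : ∀ p : ellipsoid r, ∃ γ : ℝ → ellipsoid r, γ 0 = p ∧
      ∀ t, HasDerivAt (fun s => (γ s : E3)) (rikitake β (γ t)) t := by
    intro p
    have hpos : ∀ q : E3, 0 < 1 + casimir q := fun q => by linarith [casimir_nonneg q]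
    have hr : 0 < 1 + r := by
      have h := hpos p
      rwa [show casimir p = r from p.2] at h
    -- A bounded field that is still tangent to the levels of `C` and agrees with the Rikitake field
    -- where `C = r`.
    set V : E3 → E3 := fun q => ((1 + r) / (1 + casimir q)) • rikitake β q with hV
    have hVs : ContDiff ℝ 1 V := by
      have h1 : ContDiff ℝ 1 casimir := contDiff_casimir.of_le (by simp)
      have h2 : ContDiff ℝ 1 (rikitake β) := (contDiff_rikitake β).of_le (by simp)
      exact (contDiff_const.div (contDiff_const.add h1) fun q => (hpos q).ne').smul h2
    have hbound : ∀ q, ‖V q‖ ≤ (((1 + r) * (3 * (1 + |β|))).toNNReal : ℝ) := by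
      intro q
      rw [Real.coe_toNNReal _ (by positivity), hV, norm_smul, Real.norm_eq_abs,
        abs_of_pos (div_pos hr (hpos q)), div_mul_eq_mul_div, div_le_iff₀ (hpos q)]
      nlinarith [mul_le_mul_of_nonneg_left (norm_rikitake_le β q) hr.le]
    obtain ⟨γ, h0, hγ⟩ := exists_isIntegralCurve_of_contDiff_of_bounded hVs hbound p
    have hC : ∀ t, casimir (γ t) = r := by
      have hd : ∀ t, HasDerivAt (fun s => casimir (γ s)) 0 t := fun t => by
        refine (hasDerivAt_casimir_comp (hγ t)).congr_deriv ?_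
        simp [hV, rikitake]
        ring
      intro t
      have := is_const_of_deriv_eq_zero (fun s => (hd s).differentiableAt)
        (fun s => (hd s).deriv) t 0
      rw [this, h0]
      exact p.2
    refine ⟨fun t => ⟨γ t, hC t⟩, Subtype.ext h0, fun t => ?_⟩
    have := hγ t
    simp only [hV, hC t, div_self hr.ne', one_smul] at this
    exact this
  choose γ h0 hγ using key
  exact ⟨fun t p => γ p t, h0, fun p t => hγ p t⟩

/-! ### The symplectic leaf through the pole -/

theorem partials_apply (i : Fin 3) (p : E3) : partials (fun q => q i) p = Pi.single i 1 := by
  have h : HasFDerivAt (fun q : E3 => q i) (EuclideanSpace.proj i : E3 →L[ℝ] ℝ) p :=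
    (EuclideanSpace.proj i : E3 →L[ℝ] ℝ).hasFDerivAt
  funext j
  rw [partials, h.fderiv]
  simp [Pi.single_apply, eq_comm]

theorem partials_casimir (p : E3) : partials casimir p = ![p 0, p 1, 2 * p 2] := by
  funext j
  rw [partials, (hasFDerivAt_casimir p).fderiv]
  fin_cases j <;> simp

/-- The Hamiltonian vector field of `f` is `∇f × ∇C`. -/
theorem hamiltonianField_eq (f : E3 → ℝ) (p : E3) :
    hamiltonianField f p =
      !₂[partials f p 1 * (2 * p 2) - partials f p 2 * p 1,
        partials f p 2 * p 0 - partials f p 0 * (2 * p 2),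
        partials f p 0 * p 1 - partials f p 1 * p 0] := by
  ext i
  fin_cases i <;>
    simp [hamiltonianField, poissonBracket, partials_apply, partials_casimir, Matrix.det_fin_three]
    <;> ring

/-- `∇f × ∇C` is orthogonal to `∇C`. Right derivatives suffice, which suits a curve given on a
closed interval only. -/
theorem HamiltonianStep.casimir_eq {p q : E3} (h : HamiltonianStep p q) :
    casimir q = casimir p := by
  obtain ⟨f, -, γ, s, t, hst, hγ, rfl, rfl⟩ := h
  refine constant_of_has_deriv_right_zero (f := fun u => casimir (γ u)) (a := s) (b := t)
    (fun u hu => ?_) (fun u hu => ?_) t (right_mem_Icc.2 hst)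
  · exact (contDiff_casimir.continuous.continuousAt).comp_continuousWithinAt
      (hγ u hu).continuousWithinAt
  · have h1 : HasDerivWithinAt γ (hamiltonianField f (γ u)) (Ici u) u :=
      (hγ u (Ico_subset_Icc_self hu)).mono_of_mem_nhdsWithin (Icc_mem_nhdsGE_of_mem hu)
    refine HasDerivWithinAt.congr_deriv ((hasFDerivAt_casimir (γ u)).comp_hasDerivWithinAt u h1) ?_
    simp [hamiltonianField_eq]
    ring

theorem exists_nonneg_angle {c s : ℝ} (h : c ^ 2 + s ^ 2 = 1) :
    ∃ θ : ℝ, 0 ≤ θ ∧ Real.cos θ = c ∧ Real.sin θ = s := by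
  have hn : ‖(⟨c, s⟩ : ℂ)‖ = 1 := by
    rw [← sq_eq_sq₀ (norm_nonneg _) zero_le_one, ← Complex.normSq_eq_norm_sq, Complex.normSq_mk]
    linarith
  have h0 : (⟨c, s⟩ : ℂ) ≠ 0 := norm_ne_zero_iff.1 (by rw [hn]; exact one_ne_zero)
  -- The added turn makes the angle nonnegative, as a Hamiltonian step runs forward in time.
  refine ⟨Complex.arg ⟨c, s⟩ + 2 * Real.pi, ?_, ?_, ?_⟩
  · linarith [Complex.neg_pi_lt_arg (⟨c, s⟩ : ℂ), Real.pi_pos]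
  · rw [Real.cos_add_two_pi, Complex.cos_arg h0, hn, div_one]
  · rw [Real.sin_add_two_pi, Complex.sin_arg, hn, div_one]

/-- Flowing along the Hamiltonian field of `x` turns the ellipse `y² / 2 + z² = M²`. -/
theorem hamiltonianStep_turn_x {M y z : ℝ} (hM : M ≠ 0) (h : y ^ 2 / 2 + z ^ 2 = M ^ 2) :
    HamiltonianStep !₂[0, 0, M] !₂[0, y, z] := by
  have h2 : √2 ^ 2 = (2 : ℝ) := Real.sq_sqrt (by norm_num)
  have hs : √2 ≠ (0 : ℝ) := by positivity
  obtain ⟨θ, hθ, hc, hs'⟩ := exists_nonneg_angle (c := z / M) (s := -(y / (√2 * M))) (by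
    field_simp
    rw [h2]; linarith)
  -- The Hamiltonian equations of `x` are `y' = -2z`, `z' = y`, an oscillator of frequency `√2`.
  refine ⟨fun q => q 0, by fun_prop, fun t => !₂[0, -(√2 * M * Real.sin (√2 * t)),
    M * Real.cos (√2 * t)], 0, θ / √2, by positivity, fun t _ => ?_, ?_, ?_⟩
  · refine (hasDerivAt_E3 fun i => ?_).hasDerivWithinAt
    have hl : HasDerivAt (fun t : ℝ => √2 * t) √2 t := by
      simpa using (hasDerivAt_id t).const_mul √2
    beta_reduce
    rw [hamiltonianField_eq, partials_apply]
    fin_cases i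
    · simpa using hasDerivAt_const t (0 : ℝ)
    · refine HasDerivAt.congr_deriv (hl.sin.const_mul (√2 * M)).neg ?_
      simp
      linear_combination (M * Real.cos (√2 * t)) * h2
    · refine HasDerivAt.congr_deriv (hl.cos.const_mul M) ?_
      simp
      ring
  · simp
  · beta_reduce
    rw [mul_div_cancel₀ θ hs, hc, hs']
    congr 1
    ext i
    fin_cases i <;> simp <;> field_simp

/-- Flowing along the Hamiltonian field of `z` rotates around the `z`-axis. -/
theorem hamiltonianStep_rotate (x y z : ℝ) :
    HamiltonianStep !₂[0, √(x ^ 2 + y ^ 2), z] !₂[x, y, z] := by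
  set ρ := √(x ^ 2 + y ^ 2) with hρ
  have hρ2 : ρ ^ 2 = x ^ 2 + y ^ 2 := Real.sq_sqrt (by positivity)
  obtain ⟨θ, hθ, hc, hs⟩ : ∃ θ : ℝ, 0 ≤ θ ∧ ρ * Real.cos θ = y ∧ -(ρ * Real.sin θ) = x := by
    rcases eq_or_ne ρ 0 with h0 | h0
    · rw [h0] at hρ2
      have hx : x = 0 := by nlinarith
      have hy : y = 0 := by nlinarith
      exact ⟨0, le_rfl, by simp [h0, hy], by simp [h0, hx]⟩
    · obtain ⟨θ, hθ, hc, hs⟩ := exists_nonneg_angle (c := y / ρ) (s := -(x / ρ)) (by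
        field_simp
        linarith)
      exact ⟨θ, hθ, by rw [hc]; field_simp, by rw [hs]; field_simp⟩
  refine ⟨fun q => q 2, by fun_prop, fun t => !₂[-(ρ * Real.sin t), ρ * Real.cos t, z],
    0, θ, hθ, fun t _ => ?_, by simp, by simp [hc, hs]⟩
  refine (hasDerivAt_E3 fun i => ?_).hasDerivWithinAt
  beta_reduce
  rw [hamiltonianField_eq, partials_apply]
  fin_cases i
  · exact HasDerivAt.congr_deriv ((Real.hasDerivAt_sin t).const_mul ρ).neg (by simp)
  · simpa using (Real.hasDerivAt_cos t).const_mul ρ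
  · simpa using hasDerivAt_const t z

theorem symplecticLeaf_pole {M : ℝ} (hM : M ≠ 0) :
    symplecticLeaf (pole M : E3) = ellipsoid (M ^ 2) := by
  apply Subset.antisymm
  · intro q hq
    induction hq with
    | refl => exact (pole M).2
    | tail _ h ih => exact h.casimir_eq.trans ih
  · intro q hq
    have hq' : (q 0 ^ 2 + q 1 ^ 2) / 2 + q 2 ^ 2 = M ^ 2 := hq
    have e : q = !₂[q 0, q 1, q 2] := by ext i; fin_cases i <;> rfl
    refine .tail (.single (hamiltonianStep_turn_x (y := √(q 0 ^ 2 + q 1 ^ 2)) (z := q 2) hM ?_)) ?_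
    · rw [Real.sq_sqrt (by positivity), hq']
    · rw [e]
      exact hamiltonianStep_rotate _ _ _

/-! ### Coordinates of the flow and growth of the distance to the pole -/

namespace IsLeafFlow

variable {β r : ℝ} {φ : ℝ → ellipsoid r → ellipsoid r}

theorem hasDerivAt_zero (h : IsLeafFlow β φ) (q : ellipsoid r) (t : ℝ) :
    HasDerivAt (fun s => (φ s q : E3) 0)
      ((φ t q : E3) 1 * (φ t q : E3) 2 + β * (φ t q : E3) 1) t := by
  simpa [leafField, rikitake] using (h.hasDerivAt q t).E3_apply 0

theorem hasDerivAt_one (h : IsLeafFlow β φ) (q : ellipsoid r) (t : ℝ) :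
    HasDerivAt (fun s => (φ s q : E3) 1)
      ((φ t q : E3) 0 * (φ t q : E3) 2 - β * (φ t q : E3) 0) t := by
  simpa [leafField, rikitake] using (h.hasDerivAt q t).E3_apply 1

theorem hasDerivAt_two (h : IsLeafFlow β φ) (q : ellipsoid r) (t : ℝ) :
    HasDerivAt (fun s => (φ s q : E3) 2) (-((φ t q : E3) 0 * (φ t q : E3) 1)) t := by
  simpa [leafField, rikitake] using (h.hasDerivAt q t).E3_apply 2

theorem continuous_orbit (h : IsLeafFlow β φ) (q : ellipsoid r) : Continuous fun t => φ t q :=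
  Continuous.subtype_mk
    (continuous_iff_continuousAt.2 fun t => (h.hasDerivAt q t).continuousAt) _

end IsLeafFlow

theorem ellipsoid_eq {M : ℝ} (q : ellipsoid (M ^ 2)) :
    (q : E3) 0 ^ 2 + (q : E3) 1 ^ 2 = 2 * (M ^ 2 - (q : E3) 2 ^ 2) := by
  have h : ((q : E3) 0 ^ 2 + (q : E3) 1 ^ 2) / 2 + (q : E3) 2 ^ 2 = M ^ 2 := q.2
  linarith

theorem ellipsoid_abs_le {M : ℝ} (q : ellipsoid (M ^ 2)) : |(q : E3) 2| ≤ |M| :=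
  sq_le_sq.1 (by nlinarith [ellipsoid_eq q, sq_nonneg ((q : E3) 0), sq_nonneg ((q : E3) 1)])

theorem norm_sub_pole_sq {M : ℝ} (q : ellipsoid (M ^ 2)) :
    ‖(q : E3) - (pole M : E3)‖ ^ 2 =
      (q : E3) 0 ^ 2 + (q : E3) 1 ^ 2 + ((q : E3) 2 - M) ^ 2 := by
  simp [E3.norm_sq_eq, pole]

/-- A differentiable function with `|f'| ≤ K f` grows at most exponentially. -/
theorem le_exp_mul_of_abs_deriv_le {f f' : ℝ → ℝ} {K : ℝ} (hf : ∀ t, HasDerivAt f (f' t) t)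
    (hK : ∀ t, |f' t| ≤ K * f t) (t : ℝ) : f t ≤ Real.exp (K * |t|) * f 0 := by
  have hd : ∀ c s : ℝ, HasDerivAt (fun s => Real.exp (c * s) * f s)
      (Real.exp (c * s) * (c * f s + f' s)) s := fun c s => by
    have h1 : HasDerivAt (fun s : ℝ => c * s) c s := by
      simpa using (hasDerivAt_id s).const_mul c
    exact HasDerivAt.congr_deriv (h1.exp.mul (hf s)) (by ring)
  rcases le_total 0 t with ht | ht
  · have hanti : Antitone fun s => Real.exp (-K * s) * f s :=
      antitone_of_hasDerivAt_nonpos (hd (-K)) fun s =>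
        mul_nonpos_of_nonneg_of_nonpos (Real.exp_pos _).le (by linarith [(abs_le.1 (hK s)).2])
    have := hanti ht
    simp only [mul_zero, Real.exp_zero, one_mul, neg_mul, Real.exp_neg] at this
    rw [abs_of_nonneg ht]
    rwa [inv_mul_le_iff₀ (Real.exp_pos _)] at this
  · have hmono : Monotone fun s => Real.exp (K * s) * f s :=
      monotone_of_hasDerivAt_nonneg (hd K) fun s =>
        mul_nonneg (Real.exp_pos _).le (by linarith [(abs_le.1 (hK s)).1])
    have := hmono ht
    simp only [mul_zero, Real.exp_zero, one_mul] at this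
    rw [abs_of_nonpos ht, mul_neg, Real.exp_neg]
    rwa [le_inv_mul_iff₀ (Real.exp_pos _)]

/-- In the derivative of the squared distance the terms with `β` cancel and `2 x y (z + M)` remains.
Here `|2 x y| ≤ x² + y²` and `|z + M| ≤ 2 |M|` on the ellipsoid. -/
theorem IsLeafFlow.norm_sub_pole_sq_le {β M : ℝ} {φ : ℝ → ellipsoid (M ^ 2) → ellipsoid (M ^ 2)}
    (h : IsLeafFlow β φ) (q : ellipsoid (M ^ 2)) (t : ℝ) :
    ‖(φ t q : E3) - (pole M : E3)‖ ^ 2 ≤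
      Real.exp (2 * |M| * |t|) * ‖(q : E3) - (pole M : E3)‖ ^ 2 := by
  have := le_exp_mul_of_abs_deriv_le (K := 2 * |M|)
    (f := fun t => ‖(φ t q : E3) - (pole M : E3)‖ ^ 2)
    (f' := fun t => 2 * ((φ t q : E3) 0 * (φ t q : E3) 1) * ((φ t q : E3) 2 + M))
    (fun t => by
      simp_rw [norm_sub_pole_sq]
      refine HasDerivAt.congr_deriv ((((h.hasDerivAt_zero q t).pow 2).add
        ((h.hasDerivAt_one q t).pow 2)).add (((h.hasDerivAt_two q t).sub_const M).pow 2)) ?_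
      simp
      ring)
    (fun t => by
      simp only [norm_sub_pole_sq]
      generalize φ t q = p
      have h1 : |(p : E3) 2 + M| ≤ 2 * |M| :=
        (abs_add_le _ _).trans (by linarith [ellipsoid_abs_le p])
      have h2 : |2 * ((p : E3) 0 * (p : E3) 1)| ≤ (p : E3) 0 ^ 2 + (p : E3) 1 ^ 2 := by
        rw [abs_le]
        constructor <;>
        nlinarith [sq_nonneg ((p : E3) 0 - (p : E3) 1),
          sq_nonneg ((p : E3) 0 + (p : E3) 1)]
      rw [abs_mul]
      calc _ ≤ ((p : E3) 0 ^ 2 + (p : E3) 1 ^ 2) * (2 * |M|) := by gcongr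
        _ ≤ _ := by nlinarith [mul_nonneg (abs_nonneg M) (sq_nonneg ((p : E3) 2 - M))]) t
  simpa [h.map_zero] using this

theorem IsLeafFlow.apply_pole {β M : ℝ} {φ : ℝ → ellipsoid (M ^ 2) → ellipsoid (M ^ 2)}
    (h : IsLeafFlow β φ) (t : ℝ) : φ t (pole M) = pole M := by
  have := h.norm_sub_pole_sq_le (pole M) t
  rw [sub_self, norm_zero, zero_pow two_ne_zero, mul_zero] at this
  have h0 : ‖(φ t (pole M) : E3) - (pole M : E3)‖ = 0 := by
    nlinarith [norm_nonneg ((φ t (pole M) : E3) - (pole M : E3))]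
  exact Subtype.ext (sub_eq_zero.1 (norm_eq_zero.1 h0))

/-! ### The linearization at the pole -/

/-- The derivative of the Rikitake field at `(0, 0, M)`. -/
noncomputable def poleLinearPart (β M : ℝ) : E3 →L[ℝ] E3 :=
  (EuclideanSpace.proj 1 : E3 →L[ℝ] ℝ).smulRight (EuclideanSpace.single 0 (M + β)) +
    (EuclideanSpace.proj 0 : E3 →L[ℝ] ℝ).smulRight (EuclideanSpace.single 1 (M - β))

theorem poleLinearPart_apply (β M : ℝ) (v : E3) :
    poleLinearPart β M v = !₂[(M + β) * v 1, (M - β) * v 0, 0] := by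
  ext i
  fin_cases i <;> simp [poleLinearPart, mul_comm]

/-- The remainder is exactly `(y (z - M), x (z - M), -x y)`. -/
theorem norm_rikitake_sub_linearPart_le (β M : ℝ) (p : E3) :
    ‖rikitake β p - poleLinearPart β M (p - (pole M : E3))‖ ≤ ‖p - (pole M : E3)‖ ^ 2 := by
  refine abs_le_of_sq_le_sq' ?_ (sq_nonneg _) |>.2
  rw [E3.norm_sq_eq, E3.norm_sq_eq]
  simp [poleLinearPart_apply, rikitake, pole]
  nlinarith [sq_nonneg (p 0 * p 1), sq_nonneg (p 0 * (p 2 - M)), sq_nonneg (p 1 * (p 2 - M)),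
    sq_nonneg (p 0 ^ 2), sq_nonneg (p 1 ^ 2), sq_nonneg ((p 2 - M) ^ 2)]

open NormedSpace in
theorem exp_zero_smul {𝔸 : Type*} [NormedRing 𝔸] [NormedAlgebra ℝ 𝔸] (A : 𝔸) :
    exp ((0 : ℝ) • A) = 1 := by
  simp

open NormedSpace in
theorem exp_smul_mul_exp_smul_neg {𝔸 : Type*} [NormedRing 𝔸] [NormedAlgebra ℝ 𝔸] [CompleteSpace 𝔸]
    (A : 𝔸) (t : ℝ) : exp (t • A) * exp (t • -A) = 1 := by
  let _ : NormedAlgebra ℚ 𝔸 := NormedAlgebra.restrictScalars ℚ ℝ 𝔸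
  rw [← exp_add_of_commute]
  · simp
  · exact (Commute.refl A).smul_left t |>.smul_right t |>.neg_right |> fun h => by simp at h ⊢

open NormedSpace in
/-- Near the pole the flow is the linear flow up to an error of second order. -/
theorem IsLeafFlow.exists_norm_sub_exp_le {β M : ℝ}
    {φ : ℝ → ellipsoid (M ^ 2) → ellipsoid (M ^ 2)} (h : IsLeafFlow β φ) (t : ℝ) :
    ∃ C, ∀ q : ellipsoid (M ^ 2),
      ‖((φ t q : E3) - (pole M : E3)) -
        exp (t • poleLinearPart β M) ((q : E3) - (pole M : E3))‖ ≤
      C * ‖(q : E3) - (pole M : E3)‖ ^ 2 := by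
  set A := poleLinearPart β M
  have hcont : Continuous fun s : ℝ => exp (s • -A) :=
    continuous_iff_continuousAt.2 fun s => (hasDerivAt_exp_smul_const (𝕂 := ℝ) (-A) s).continuousAt
  obtain ⟨G, hG⟩ := (isCompact_Icc (a := -|t|) (b := |t|)).exists_bound_of_continuousOn
    hcont.continuousOn
  have hG0 : 0 ≤ G := (norm_nonneg _).trans (hG 0 (by simp))
  refine ⟨‖exp (t • A)‖ * (G * Real.exp (2 * |M| * |t|) * |t|), fun q => ?_⟩
  set v : ℝ → E3 := fun s => (φ s q : E3) - (pole M : E3) with hv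
  -- Variation of constants: undoing the linear flow leaves only the quadratic remainder in the
  -- derivative.
  have hw : ∀ s, HasDerivAt (fun s => exp (s • -A) (v s))
      (exp (s • -A) (rikitake β (φ s q) - A (v s))) s := fun s => by
    refine HasDerivAt.congr_deriv ((hasDerivAt_exp_smul_const (𝕂 := ℝ) (-A) s).clm_apply
      ((h.hasDerivAt q s).sub_const _)) ?_
    simp [leafField, hv, sub_eq_add_neg, add_comm]
  have hbound : ∀ s ∈ Icc (-|t|) |t|, ‖exp (s • -A) (rikitake β (φ s q) - A (v s))‖ ≤
      G * (Real.exp (2 * |M| * |t|) * ‖v 0‖ ^ 2) := fun s hs => by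
    refine (ContinuousLinearMap.le_opNorm _ _).trans
      (mul_le_mul (hG s hs) ?_ (norm_nonneg _) hG0)
    refine (norm_rikitake_sub_linearPart_le β M _).trans ((h.norm_sub_pole_sq_le q s).trans ?_)
    simp only [hv, h.map_zero]
    exact mul_le_mul_of_nonneg_right (Real.exp_le_exp.2
      (mul_le_mul_of_nonneg_left (abs_le.2 hs) (by positivity))) (sq_nonneg _)
  have hmv := (convex_Icc (-|t|) |t|).norm_image_sub_le_of_norm_hasDerivWithin_le
    (fun s _ => (hw s).hasDerivWithinAt) hbound (x := 0) (y := t) (by simp)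
    ⟨neg_abs_le t, le_abs_self t⟩
  have hv0 : v 0 = (q : E3) - (pole M : E3) := by simp [hv, h.map_zero]
  have hexp : exp (t • A) (exp (t • -A) (v t)) = v t :=
    DFunLike.congr_fun (exp_smul_mul_exp_smul_neg A t) (v t)
  rw [show (φ t q : E3) - (pole M : E3) = v t from rfl, ← hexp, ← hv0, ← map_sub]
  refine (ContinuousLinearMap.le_opNorm _ _).trans ?_
  rw [mul_assoc]
  refine mul_le_mul_of_nonneg_left ?_ (norm_nonneg _)
  have h0 : exp ((0 : ℝ) • -A) (v 0) = v 0 :=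
    DFunLike.congr_fun (exp_zero_smul (-A)) (v 0)
  rw [h0, sub_zero, Real.norm_eq_abs] at hmv
  linarith

theorem mem_leafTangent_pole {M : ℝ} (hM : M ≠ 0) {v : E3} :
    v ∈ leafTangent (pole M : E3) ↔ v 2 = 0 := by
  rw [LinearMap.mem_ker]
  simp [(hasFDerivAt_casimir _).fderiv, pole, hM]

theorem orthogonalProjectionOnto_leafTangent_pole {M : ℝ} (hM : M ≠ 0) (v : E3) :
    ((leafTangent (pole M : E3)).orthogonalProjectionOnto v : E3) = !₂[v 0, v 1, 0] := by
  refine Submodule.eq_starProjection_of_mem_of_inner_eq_zero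
    ((mem_leafTangent_pole hM).2 (by simp)) fun w hw => ?_
  rw [mem_leafTangent_pole hM] at hw
  simp [PiLp.inner_apply, Fin.sum_univ_three, hw]

/-- The error of the projection is `|z - M|`. Centered at the pole, the equation of the ellipsoid
reads `-4 M (z - M) = x² + y² + 2 (z - M)²`, so this error is of second order. -/
theorem norm_sub_orthogonalProjectionOnto_le {M : ℝ} (hM : M ≠ 0) (q : ellipsoid (M ^ 2)) :
    ‖((q : E3) - (pole M : E3)) -
        ((leafTangent (pole M : E3)).orthogonalProjectionOnto ((q : E3) - (pole M : E3)) : E3)‖ ≤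
      1 / (2 * |M|) * ‖(q : E3) - (pole M : E3)‖ ^ 2 := by
  have hM' := abs_pos.2 hM
  have hz : ‖((q : E3) - (pole M : E3)) -
        ((leafTangent (pole M : E3)).orthogonalProjectionOnto ((q : E3) - (pole M : E3)) : E3)‖ =
      |(q : E3) 2 - M| := by
    rw [← abs_of_nonneg (norm_nonneg _), ← sq_eq_sq_iff_abs_eq_abs, E3.norm_sq_eq,
      orthogonalProjectionOnto_leafTangent_pole hM]
    simp [pole]
  rw [hz, norm_sub_pole_sq, ellipsoid_eq, div_mul_eq_mul_div, le_div_iff₀ (by positivity)]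
  have h2 : 0 ≤ M ^ 2 - (q : E3) 2 ^ 2 := by
    nlinarith [ellipsoid_eq q, sq_nonneg ((q : E3) 0), sq_nonneg ((q : E3) 1)]
  have : |((q : E3) 2 - M) * (4 * M)| ≤ 2 * (2 * (M ^ 2 - (q : E3) 2 ^ 2) + ((q : E3) 2 - M) ^ 2) := by
    rw [abs_le]
    constructor <;> nlinarith
  rw [abs_mul, abs_mul, abs_of_pos (by norm_num : (0 : ℝ) < 4)] at this
  linarith

theorem IsLeafFlow.hasLeafDerivAt_pole {β M : ℝ} (hM : M ≠ 0)
    {φ : ℝ → ellipsoid (M ^ 2) → ellipsoid (M ^ 2)} (h : IsLeafFlow β φ) (t : ℝ) :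
    HasLeafDerivAt (φ t) (pole M)
      ((NormedSpace.exp (t • poleLinearPart β M)).comp (leafTangent (pole M : E3)).subtypeL) := by
  obtain ⟨C, hC⟩ := h.exists_norm_sub_exp_le t
  set S := NormedSpace.exp (t • poleLinearPart β M)
  have hbound : ∀ q : ellipsoid (M ^ 2), ‖(φ t q : E3) - (φ t (pole M) : E3) -
      S.comp (leafTangent (pole M : E3)).subtypeL
        ((leafTangent (pole M : E3)).orthogonalProjectionOnto ((q : E3) - (pole M : E3)))‖ ≤
      (C + ‖S‖ * (1 / (2 * |M|))) * ‖(q : E3) - (pole M : E3)‖ ^ 2 := fun q => by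
    rw [h.apply_pole]
    set u := (q : E3) - (pole M : E3) with hu
    have e : (φ t q : E3) - (pole M : E3) - S.comp (leafTangent (pole M : E3)).subtypeL
        ((leafTangent (pole M : E3)).orthogonalProjectionOnto u) =
        ((φ t q : E3) - (pole M : E3) - S u) +
          S (u - ((leafTangent (pole M : E3)).orthogonalProjectionOnto u : E3)) := by
      rw [map_sub]
      simp
    rw [e, add_mul, mul_assoc]
    exact norm_add_le_of_le (hC q) ((S.le_opNorm _).trans
      (mul_le_mul_of_nonneg_left (norm_sub_orthogonalProjectionOnto_le hM q) (norm_nonneg _)))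
  have hO : (fun q : ellipsoid (M ^ 2) => (φ t q : E3) - (φ t (pole M) : E3) -
      S.comp (leafTangent (pole M : E3)).subtypeL
        ((leafTangent (pole M : E3)).orthogonalProjectionOnto ((q : E3) - (pole M : E3))))
      =O[𝓝 (pole M)] fun q => ‖(q : E3) - (pole M : E3)‖ ^ 2 :=
    Asymptotics.IsBigO.of_bound _ (.of_forall fun q => by
      simpa using hbound q)
  have ht : Tendsto (fun q : ellipsoid (M ^ 2) => (q : E3) - (pole M : E3)) (𝓝 (pole M)) (𝓝 0) := by
    have : Continuous fun q : ellipsoid (M ^ 2) => (q : E3) - (pole M : E3) := by fun_prop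
    simpa using this.tendsto (pole M)
  exact hO.trans_isLittleO ((Asymptotics.isLittleO_norm_pow_id one_lt_two).comp_tendsto ht)

/-- A curve in the ellipsoid through the pole with velocity along `(c, s, 0)`. -/
noncomputable def meridian (M : ℝ) {c s : ℝ} (h : c ^ 2 + s ^ 2 = 1) (t : ℝ) : ellipsoid (M ^ 2) :=
  ⟨!₂[√2 * M * Real.sin t * c, √2 * M * Real.sin t * s, M * Real.cos t], by
    have h2 : √2 ^ 2 = (2 : ℝ) := Real.sq_sqrt (by norm_num)
    have h3 := Real.sin_sq_add_cos_sq t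
    simp only [ellipsoid, casimir, mem_ofPred_eq]
    simp
    linear_combination (√2 ^ 2 * M ^ 2 * Real.sin t ^ 2 / 2) * h + (M ^ 2 * Real.sin t ^ 2 / 2) * h2
      + M ^ 2 * h3⟩

theorem meridian_zero (M : ℝ) {c s : ℝ} (h : c ^ 2 + s ^ 2 = 1) : meridian M h 0 = pole M :=
  Subtype.ext (by simp [meridian, pole])

theorem hasDerivAt_meridian (M : ℝ) {c s : ℝ} (h : c ^ 2 + s ^ 2 = 1) :
    HasDerivAt (fun t => (meridian M h t : E3)) !₂[√2 * M * c, √2 * M * s, 0] 0 := by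
  refine hasDerivAt_E3 fun i => ?_
  have hs := (Real.hasDerivAt_sin 0).const_mul (√2 * M)
  fin_cases i
  · exact HasDerivAt.congr_deriv (hs.mul_const c) (by simp)
  · exact HasDerivAt.congr_deriv (hs.mul_const s) (by simp)
  · exact HasDerivAt.congr_deriv ((Real.hasDerivAt_cos 0).const_mul M) (by simp)

/-- The differential at the pole of a map of the ellipsoid is unique. -/
theorem HasLeafDerivAt.unique {M : ℝ} (hM : M ≠ 0) {f : ellipsoid (M ^ 2) → ellipsoid (M ^ 2)}
    {D D' : leafTangent (pole M : E3) →L[ℝ] E3} (h : HasLeafDerivAt f (pole M) D)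
    (h' : HasLeafDerivAt f (pole M) D') : D = D' := by
  have hlin : ∀ v : leafTangent (pole M : E3), (v : E3) 0 ^ 2 + (v : E3) 1 ^ 2 = 1 →
      (D - D') v = 0 := by
    intro v hv
    have hd := hasDerivAt_meridian M hv
    have ht : Tendsto (meridian M hv) (𝓝 0) (𝓝 (pole M)) :=
      tendsto_subtype_rng.2 (by simpa [meridian_zero] using hd.continuousAt.tendsto)
    have ho : (fun q : ellipsoid (M ^ 2) => (D - D')
        ((leafTangent (pole M : E3)).orthogonalProjectionOnto ((q : E3) - (pole M : E3))))
        =o[𝓝 (pole M)] fun q : ellipsoid (M ^ 2) => (q : E3) - (pole M : E3) :=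
      (h'.sub h).congr_left fun q => by simp
    have hb : (fun t => (meridian M hv t : E3) - (pole M : E3)) =O[𝓝 0] fun t : ℝ => t - 0 := by
      simpa [meridian_zero] using hd.isBigO_sub
    have ho' := (ho.comp_tendsto ht).trans_isBigO hb
    have hproj : ∀ t : ℝ, (leafTangent (pole M : E3)).orthogonalProjectionOnto
        ((meridian M hv t : E3) - (pole M : E3)) = (√2 * M * Real.sin t) • v := fun t => by
      have hv2 := (mem_leafTangent_pole hM).1 v.2
      refine Subtype.ext ((orthogonalProjectionOnto_leafTangent_pole hM _).trans ?_)
      change _ = (√2 * M * Real.sin t) • (v : E3)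
      ext i
      fin_cases i <;> simp [meridian, pole, hv2]
    -- Along the meridian the difference of the two differentials is `o(t)`, yet its derivative at
    -- `0` is `√2 M` times `(D - D') v`.
    have h1 : HasDerivAt (fun t : ℝ => (√2 * M * Real.sin t) • (D - D') v) 0 0 := by
      rw [hasDerivAt_iff_isLittleO]
      refine ho'.congr_left fun t => ?_
      rw [Function.comp_apply, hproj, map_smul]
      simp
    have h2 : HasDerivAt (fun t : ℝ => (√2 * M * Real.sin t) • (D - D') v)
        ((√2 * M * Real.cos 0) • (D - D') v) 0 :=
      ((Real.hasDerivAt_sin 0).const_mul (√2 * M)).smul_const _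
    have h3 := h2.unique h1
    rw [Real.cos_zero, mul_one] at h3
    exact (smul_eq_zero.1 h3).resolve_left (by positivity)
  ext1 v
  rw [← sub_eq_zero, ← sub_apply]
  have hv2 := (mem_leafTangent_pole hM).1 v.2
  rcases eq_or_ne ((v : E3) 0 ^ 2 + (v : E3) 1 ^ 2) 0 with h0 | h0
  · have : v = 0 := by
      refine Subtype.ext ?_
      ext i
      fin_cases i
      · simp; nlinarith
      · simp; nlinarith
      · simpa using hv2
    rw [this, map_zero]
  · set ℓ := √((v : E3) 0 ^ 2 + (v : E3) 1 ^ 2)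
    have hℓ2 : ℓ ^ 2 = (v : E3) 0 ^ 2 + (v : E3) 1 ^ 2 := Real.sq_sqrt (by positivity)
    have hℓ : ℓ ≠ 0 := fun h => h0 (by rw [← hℓ2, h]; simp)
    have := hlin (ℓ⁻¹ • v) (by simp; field_simp; exact hℓ2.symm)
    rw [map_smul] at this
    exact (smul_eq_zero.1 this).resolve_left (inv_ne_zero hℓ)

theorem hasDerivAt_exp_smul_poleLinearPart (β M : ℝ) (v : E3) :
    HasDerivAt (fun t : ℝ => NormedSpace.exp (t • poleLinearPart β M) v)
      (poleLinearPart β M v) 0 := by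
  refine HasDerivAt.congr_deriv
    ((hasDerivAt_exp_smul_const (𝕂 := ℝ) (poleLinearPart β M) 0).clm_apply (hasDerivAt_const _ v)) ?_
  rw [exp_zero_smul]
  simp

theorem poleLinearPart_mem {β M : ℝ} (hM : M ≠ 0) (v : E3) :
    poleLinearPart β M v ∈ leafTangent (pole M : E3) := by
  rw [mem_leafTangent_pole hM, poleLinearPart_apply]
  simp

theorem IsLeafFlow.exists_isLinearization {β M : ℝ} (hM : M ≠ 0)
    {φ : ℝ → ellipsoid (M ^ 2) → ellipsoid (M ^ 2)} (h : IsLeafFlow β φ) :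
    ∃ L, IsLinearization φ (pole M) L :=
  ⟨(poleLinearPart β M : E3 →ₗ[ℝ] E3).restrict fun v _ => poleLinearPart_mem hM v,
    _, h.hasLeafDerivAt_pole hM, fun v => hasDerivAt_exp_smul_poleLinearPart β M v⟩

/-- The differentials chosen in `IsLinearization` are forced by `HasLeafDerivAt.unique`, so `L` is
read off from the exponential. -/
theorem IsLinearization.apply_eq {β M : ℝ} (hM : M ≠ 0)
    {φ : ℝ → ellipsoid (M ^ 2) → ellipsoid (M ^ 2)} (h : IsLeafFlow β φ)
    {L : leafTangent (pole M : E3) →ₗ[ℝ] leafTangent (pole M : E3)}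
    (hL : IsLinearization φ (pole M) L) (v : leafTangent (pole M : E3)) :
    (L v : E3) = poleLinearPart β M v := by
  obtain ⟨D, hD, hd⟩ := hL
  have e : ∀ t, D t v = NormedSpace.exp (t • poleLinearPart β M) v := fun t => by
    rw [(hD t).unique hM (h.hasLeafDerivAt_pole hM t)]
    rfl
  exact (hd v).unique (by simpa only [e] using hasDerivAt_exp_smul_poleLinearPart β M v)

/-- The coordinates `x, y` on the tangent plane at the pole. -/
noncomputable def leafTangentPoleBasis {M : ℝ} (hM : M ≠ 0) :
    Module.Basis (Fin 2) ℝ (leafTangent (pole M : E3)) :=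
  Module.Basis.ofEquivFun
    { toFun := fun v => ![(v : E3) 0, (v : E3) 1]
      map_add' := fun v w => by ext i; fin_cases i <;> simp
      map_smul' := fun c v => by ext i; fin_cases i <;> simp
      invFun := fun c => ⟨!₂[c 0, c 1, 0], (mem_leafTangent_pole hM).2 (by simp)⟩
      left_inv := fun v => by
        have hv2 := (mem_leafTangent_pole hM).1 v.2
        refine Subtype.ext ?_
        ext i
        fin_cases i <;> simp [hv2]
      right_inv := fun c => by ext i; fin_cases i <;> simp }

theorem IsLinearization.charpoly_eq {β M : ℝ} (hM : M ≠ 0)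
    {φ : ℝ → ellipsoid (M ^ 2) → ellipsoid (M ^ 2)} (h : IsLeafFlow β φ)
    {L : leafTangent (pole M : E3) →ₗ[ℝ] leafTangent (pole M : E3)}
    (hL : IsLinearization φ (pole M) L) :
    L.charpoly = Polynomial.X ^ 2 + Polynomial.C (β ^ 2 - M ^ 2) := by
  have hmat : LinearMap.toMatrix (leafTangentPoleBasis hM) (leafTangentPoleBasis hM) L =
      !![0, M + β; M - β, 0] := by
    ext i j
    rw [LinearMap.toMatrix_apply]
    fin_cases i <;> fin_cases j <;>
      simp [leafTangentPoleBasis, hL.apply_eq hM h, poleLinearPart_apply]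
  rw [← LinearMap.charpoly_toMatrix L (leafTangentPoleBasis hM), hmat, Matrix.charpoly_fin_two]
  simp [Matrix.trace_fin_two, Matrix.det_fin_two]
  ring

/-! ### Instability -/

theorem continuous_meridian (M : ℝ) {c s : ℝ} (h : c ^ 2 + s ^ 2 = 1) :
    Continuous (meridian M h) := by
  refine Continuous.subtype_mk ?_ _
  refine (PiLp.continuous_toLp 2 _).comp (continuous_pi fun i => ?_)
  fin_cases i <;> simp <;> fun_prop

theorem exists_sign_mul_abs (a : ℝ) : ∃ σ : ℝ, σ ^ 2 = 1 ∧ a = σ * |a| := by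
  rcases le_total 0 a with h | h
  · exact ⟨1, by norm_num, by rw [abs_of_nonneg h, one_mul]⟩
  · exact ⟨-1, by norm_num, by rw [abs_of_nonpos h]; ring⟩

/-- The derivative of `σ x y` is `y² (σ z + σ β) + x² (σ z - σ β)`, nonnegative while `σ z > |β|`.
Since `(σ z)' = -σ x y`, an orbit confined to that region with `σ x y > 0` at the start has `σ z`
falling at least linearly, which is impossible. -/
theorem IsLeafFlow.not_isLyapunovStable {β M : ℝ}
    {φ : ℝ → ellipsoid (M ^ 2) → ellipsoid (M ^ 2)} (h : IsLeafFlow β φ) (hβ : |β| < |M|) :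
    ¬ IsLyapunovStable φ (pole M) := by
  intro hst
  obtain ⟨σ, hσ, hMσ⟩ := exists_sign_mul_abs M
  have hm : 0 < |M| := (abs_nonneg β).trans_lt hβ
  set c := (|β| + |M|) / 2 with hc
  have hσβ : |σ * β| = |β| := by
    rw [abs_mul, (pow_eq_one_iff_of_nonneg (abs_nonneg σ) two_ne_zero).1 (by rwa [sq_abs]), one_mul]
  have hopen : IsOpen {q : ellipsoid (M ^ 2) | c < σ * (q : E3) 2} :=
    isOpen_lt continuous_const (by fun_prop)
  have hp : c < σ * (pole M : E3) 2 := by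
    have : σ * M = |M| := by
      nth_rw 1 [hMσ]
      linear_combination |M| * hσ
    simp [pole]
    linarith
  obtain ⟨V, -, hV, hpV, hφ⟩ := hst _ hopen hp
  -- The direction `(1, σ) / √2` makes `σ x y = M² sin² t` along the meridian, hence positive
  -- arbitrarily near the pole.
  have hunit : (1 / √2) ^ 2 + (σ / √2) ^ 2 = 1 := by
    rw [div_pow, div_pow, hσ, Real.sq_sqrt (by norm_num)]
    norm_num
  have hev : ∀ᶠ t in 𝓝[>] (0 : ℝ), meridian M hunit t ∈ V ∧ t ∈ Ioo 0 Real.pi := by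
    refine Filter.Eventually.and (nhdsWithin_le_nhds
      ((continuous_meridian M hunit).continuousAt.eventually_mem ?_))
      (Ioo_mem_nhdsGT Real.pi_pos)
    rw [meridian_zero]
    exact hV.mem_nhds hpV
  obtain ⟨t₀, hq, ht₀⟩ := hev.exists
  set q := meridian M hunit t₀
  have hP0 : 0 < σ * ((q : E3) 0 * (q : E3) 1) := by
    have hs := Real.sin_pos_of_pos_of_lt_pi ht₀.1 ht₀.2
    have e : σ * ((q : E3) 0 * (q : E3) 1) = M ^ 2 * Real.sin t₀ ^ 2 := by
      simp only [q, meridian]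
      simp
      field_simp
      linear_combination M ^ 2 * hσ
    rw [e]
    have : M ≠ 0 := abs_pos.1 hm
    positivity
  set P : ℝ → ℝ := fun t => σ * ((φ t q : E3) 0 * (φ t q : E3) 1) with hP
  have hdP : ∀ t, HasDerivAt P (σ * (((φ t q : E3) 1 * (φ t q : E3) 2 + β * (φ t q : E3) 1) *
      (φ t q : E3) 1 + (φ t q : E3) 0 *
      ((φ t q : E3) 0 * (φ t q : E3) 2 - β * (φ t q : E3) 0))) t := fun t =>
    ((h.hasDerivAt_zero q t).mul (h.hasDerivAt_one q t)).const_mul σ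
  have hmono : MonotoneOn P (Ici 0) := by
    refine monotoneOn_of_deriv_nonneg (convex_Ici 0)
      (fun t _ => (hdP t).continuousAt.continuousWithinAt)
      (fun t _ => (hdP t).differentiableAt.differentiableWithinAt) fun t ht => ?_
    rw [interior_Ici] at ht
    rw [(hdP t).deriv]
    have hz : c < σ * (φ t q : E3) 2 := hφ q hq t (le_of_lt ht)
    have h1 := abs_le.1 hσβ.le
    have e1 : 0 ≤ (φ t q : E3) 1 ^ 2 * (σ * (φ t q : E3) 2 + σ * β) :=
      mul_nonneg (sq_nonneg _) (by linarith)
    have e2 : 0 ≤ (φ t q : E3) 0 ^ 2 * (σ * (φ t q : E3) 2 - σ * β) :=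
      mul_nonneg (sq_nonneg _) (by linarith)
    nlinarith
  have hPle : ∀ t, 0 ≤ t → P 0 ≤ P t := fun t ht => hmono self_mem_Ici ht ht
  have hPpos : 0 < P 0 := by simpa only [hP, h.map_zero] using hP0
  have hdZ : ∀ t, HasDerivAt (fun t => σ * (φ t q : E3) 2 + P 0 * t) (P 0 - P t) t := fun t =>
    (((h.hasDerivAt_two q t).const_mul σ).add ((hasDerivAt_id t).const_mul (P 0))).congr_deriv
      (by simp only [hP]; ring)
  have hanti : AntitoneOn (fun t => σ * (φ t q : E3) 2 + P 0 * t) (Ici 0) := by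
    refine antitoneOn_of_deriv_nonpos (convex_Ici 0)
      (fun t _ => (hdZ t).continuousAt.continuousWithinAt)
      (fun t _ => (hdZ t).differentiableAt.differentiableWithinAt) fun t ht => ?_
    rw [interior_Ici] at ht
    rw [(hdZ t).deriv]
    linarith [hPle t (le_of_lt ht)]
  have hZ0 : c < σ * (φ 0 q : E3) 2 := hφ q hq 0 le_rfl
  have hc0 : 0 < c := by linarith [abs_nonneg β]
  -- By this time a fall at rate `P 0` has brought `σ z` to `0` or below, whereas it should exceed
  -- `c > 0`.
  set T := σ * (φ 0 q : E3) 2 / P 0 with hT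
  have hT0 : 0 ≤ T := div_nonneg (by linarith) hPpos.le
  have hfin := hanti self_mem_Ici hT0 hT0
  have hZT : c < σ * (φ T q : E3) 2 := hφ q hq T hT0
  have : P 0 * T = σ * (φ 0 q : E3) 2 := by rw [hT]; field_simp
  simp only [mul_zero, add_zero] at hfin
  linarith

/-! ### Angle functions on the line -/

/-- A nowhere vanishing differentiable curve in the plane has a differentiable angle. -/
theorem exists_angle_lift {ζ ζ' : ℝ → ℂ} (hζ : ∀ t, HasDerivAt ζ (ζ' t) t) (hc : Continuous ζ')
    (h0 : ∀ t, ζ t ≠ 0) :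
    ∃ R θ : ℝ → ℝ, (∀ t, 0 < R t) ∧ (∀ t, ζ t = R t * Complex.exp (θ t * Complex.I)) ∧
      ∀ t, HasDerivAt θ (ζ' t / ζ t).im t := by
  have hψ : Continuous fun t => ζ' t / ζ t :=
    hc.div (continuous_iff_continuousAt.2 fun t => (hζ t).continuousAt) h0
  -- A global logarithm of `ζ / ζ 0`; its imaginary part is the change of angle.
  set Ψ : ℝ → ℂ := fun t => ∫ s in (0 : ℝ)..t, ζ' s / ζ s
  have hΨ : ∀ t, HasDerivAt Ψ (ζ' t / ζ t) t := fun t =>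
    intervalIntegral.integral_hasDerivAt_right (hψ.intervalIntegrable _ _)
      (hψ.stronglyMeasurableAtFilter _ _) hψ.continuousAt
  have hd : ∀ t, HasDerivAt (fun t => ζ t * Complex.exp (-Ψ t)) 0 t := fun t => by
    refine ((hζ t).mul (hΨ t).neg.cexp).congr_deriv ?_
    field_simp [h0 t]
    ring
  have hconst : ∀ t, ζ t = ζ 0 * Complex.exp (Ψ t) := fun t => by
    have h1 := is_const_of_deriv_eq_zero (fun s => (hd s).differentiableAt)
      (fun s => (hd s).deriv) t 0
    have hΨ0 : Ψ 0 = 0 := intervalIntegral.integral_same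
    simp only [hΨ0, neg_zero, Complex.exp_zero, mul_one] at h1
    rw [← h1, mul_assoc, ← Complex.exp_add, neg_add_cancel, Complex.exp_zero, mul_one]
  refine ⟨fun t => ‖ζ 0‖ * Real.exp (Ψ t).re, fun t => (ζ 0).arg + (Ψ t).im,
    fun t => mul_pos (norm_pos_iff.2 (h0 0)) (Real.exp_pos _), fun t => ?_, fun t => ?_⟩
  · rw [hconst t]
    nth_rw 1 [← Complex.norm_mul_exp_arg_mul_I (ζ 0), ← Complex.re_add_im (Ψ t)]
    push_cast
    rw [Complex.exp_add, add_mul, Complex.exp_add]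
    ring
  · exact ((Complex.imCLM.hasFDerivAt.comp_hasDerivAt t (hΨ t)).const_add _)

/-- A function with derivative between two positive bounds is an increasing bijection. -/
theorem bijective_of_deriv_mem_Icc {θ θ' : ℝ → ℝ} {a b : ℝ} (ha : 0 < a)
    (hθ : ∀ t, HasDerivAt θ (θ' t) t) (h : ∀ t, θ' t ∈ Icc a b) :
    StrictMono θ ∧ Function.Surjective θ ∧
      ∀ s t, s ≤ t → a * (t - s) ≤ θ t - θ s ∧ θ t - θ s ≤ b * (t - s) := by
  have hd : Differentiable ℝ θ := fun t => (hθ t).differentiableAt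
  have hbound : ∀ s t, s ≤ t → a * (t - s) ≤ θ t - θ s ∧ θ t - θ s ≤ b * (t - s) :=
    fun s t hst => ⟨
      mul_sub_le_image_sub_of_le_deriv hd (fun t => by rw [(hθ t).deriv]; exact (h t).1) hst,
      image_sub_le_mul_sub_of_deriv_le hd (fun t => by rw [(hθ t).deriv]; exact (h t).2) hst⟩
  refine ⟨strictMono_of_hasDerivAt_pos hθ fun t => ha.trans_le (h t).1, ?_, hbound⟩
  refine hd.continuous.surjective ?_ ?_
  · refine tendsto_atTop_mono' _ (f₁ := fun t => θ 0 + a * t) ?_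
      (tendsto_atTop_add_const_left _ _ (tendsto_id.const_mul_atTop ha))
    filter_upwards [eventually_ge_atTop 0] with t ht
    linarith [(hbound 0 t ht).1]
  · refine tendsto_atBot_mono' _ (f₁ := fun t => θ 0 + a * t) ?_
      (tendsto_atBot_add_const_left _ _ (tendsto_id.const_mul_atBot ha))
    filter_upwards [eventually_le_atBot 0] with t ht
    linarith [(hbound t 0 ht).1]

/-! ### The energy at the pole and Lyapunov stability -/

/-- The signs `σ`, `τ` and the absolute values `m < B` of `M` and `β` in the elliptic case. -/
structure IsElliptic (β M σ τ B m : ℝ) : Prop where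
  sq_σ : σ ^ 2 = 1
  sq_τ : τ ^ 2 = 1
  eq_M : M = σ * m
  eq_β : β = τ * B
  pos : 0 < m
  lt : m < B

/-- The combination of first integrals that has a strict minimum on the ellipsoid at the pole. -/
noncomputable def poleEnergy (σ τ B m : ℝ) (q : E3) : ℝ :=
  2 * B * (m - σ * q 2) - σ * τ * (q 0 ^ 2 - q 1 ^ 2) / 2

theorem continuous_poleEnergy (σ τ B m r : ℝ) :
    Continuous fun q : ellipsoid r => poleEnergy σ τ B m q := by
  unfold poleEnergy
  fun_prop

theorem exists_isElliptic {β M : ℝ} (hM : M ≠ 0) (h : |M| < |β|) :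
    ∃ σ τ, IsElliptic β M σ τ |β| |M| := by
  obtain ⟨σ, hσ, hM'⟩ := exists_sign_mul_abs M
  obtain ⟨τ, hτ, hβ⟩ := exists_sign_mul_abs β
  exact ⟨σ, τ, hσ, hτ, hM', hβ, abs_pos.2 hM, h⟩

namespace IsElliptic

variable {β M σ τ B m : ℝ}

theorem sign_mul_sign (h : IsElliptic β M σ τ B m) : σ * τ = 1 ∨ σ * τ = -1 :=
  mul_self_eq_one_iff.1 (by rw [← sq, mul_pow, h.sq_σ, h.sq_τ, one_mul])

theorem sq_M (h : IsElliptic β M σ τ B m) : M ^ 2 = m ^ 2 := by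
  rw [h.eq_M, mul_pow, h.sq_σ, one_mul]

theorem sq_height (h : IsElliptic β M σ τ B m) (z : ℝ) : (σ * z) ^ 2 = z ^ 2 := by
  rw [mul_pow, h.sq_σ, one_mul]

theorem ellipsoid_eq' (h : IsElliptic β M σ τ B m) (q : ellipsoid (M ^ 2)) :
    (q : E3) 0 ^ 2 + (q : E3) 1 ^ 2 = 2 * (m ^ 2 - (σ * (q : E3) 2) ^ 2) := by
  rw [ellipsoid_eq, h.sq_height]
  linarith [h.sq_M]

theorem abs_height_le (h : IsElliptic β M σ τ B m) (q : ellipsoid (M ^ 2)) :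
    |σ * (q : E3) 2| ≤ m :=
  abs_le_of_sq_le_sq (by
    nlinarith [h.ellipsoid_eq' q, sq_nonneg ((q : E3) 0), sq_nonneg ((q : E3) 1)]) h.pos.le

theorem poleEnergy_pole (h : IsElliptic β M σ τ B m) : poleEnergy σ τ B m (pole M) = 0 := by
  simp [poleEnergy, pole, h.eq_M]
  right
  linear_combination (-m) * h.sq_σ

/-- Since `σ τ = ±1`, the quadratic term is at most `(x² + y²) / 2 = (m - Z) (m + Z)` in absolute
value, where `Z = σ z`. -/
theorem mul_le_poleEnergy (h : IsElliptic β M σ τ B m) (q : ellipsoid (M ^ 2)) :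
    (m - σ * (q : E3) 2) * (2 * B - m - σ * (q : E3) 2) ≤ poleEnergy σ τ B m q := by
  have h1 := h.ellipsoid_eq' q
  unfold poleEnergy
  rcases h.sign_mul_sign with hs | hs <;> rw [hs] <;>
    nlinarith [sq_nonneg ((q : E3) 0), sq_nonneg ((q : E3) 1)]

theorem depth_le_poleEnergy (h : IsElliptic β M σ τ B m) (q : ellipsoid (M ^ 2)) :
    2 * (B - m) * (m - σ * (q : E3) 2) ≤ poleEnergy σ τ B m q := by
  have h1 := h.mul_le_poleEnergy q
  have h2 := (abs_le.1 (h.abs_height_le q)).2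
  nlinarith [sq_nonneg (m - σ * (q : E3) 2)]

theorem poleEnergy_nonneg (h : IsElliptic β M σ τ B m) (q : ellipsoid (M ^ 2)) :
    0 ≤ poleEnergy σ τ B m q := by
  have h1 := h.depth_le_poleEnergy q
  have h2 := (abs_le.1 (h.abs_height_le q)).2
  have h3 : 0 ≤ 2 * (B - m) * (m - σ * (q : E3) 2) :=
    mul_nonneg (by linarith [h.lt]) (by linarith)
  linarith

/-- For `Z ≤ 0` the lower bound `(m - Z) (2B - m - Z)` is at least its value `m (2B - m)` at `Z =
0`. This threshold keeps low levels in the half of the ellipsoid around the pole. -/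
theorem height_pos (h : IsElliptic β M σ τ B m) {q : ellipsoid (M ^ 2)}
    (hq : poleEnergy σ τ B m q < m * (2 * B - m)) : 0 < σ * (q : E3) 2 := by
  by_contra! hz
  have h1 := h.mul_le_poleEnergy q
  have h2 := h.lt
  have h3 := h.pos
  nlinarith [mul_nonneg_of_nonpos_of_nonpos hz hz]

/-- The squared distance equals `(m - Z) (3m + Z) ≤ 4 m (m - Z)`, and the energy controls `m - Z`.
Hence the sublevel sets form a neighborhood basis of the pole. -/
theorem dist_pole_sq_le (h : IsElliptic β M σ τ B m) (q : ellipsoid (M ^ 2)) :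
    dist q (pole M) ^ 2 ≤ 2 * m / (B - m) * poleEnergy σ τ B m q := by
  rw [Subtype.dist_eq, dist_eq_norm, norm_sub_pole_sq, h.ellipsoid_eq']
  have hz : ((q : E3) 2 - M) ^ 2 = (m - σ * (q : E3) 2) ^ 2 := by
    linear_combination (-2 * (q : E3) 2) * h.eq_M + h.sq_M - (q : E3) 2 ^ 2 * h.sq_σ
  have h1 := h.depth_le_poleEnergy q
  have h2 := abs_le.1 (h.abs_height_le q)
  have hB : 0 < B - m := by linarith [h.lt]
  have hm := h.pos
  rw [hz, div_mul_eq_mul_div, le_div_iff₀ hB]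
  have h3 : 2 * (m ^ 2 - (σ * (q : E3) 2) ^ 2) + (m - σ * (q : E3) 2) ^ 2 ≤
      4 * m * (m - σ * (q : E3) 2) := by
    nlinarith [mul_nonneg (sub_nonneg.2 h2.2) (sub_nonneg.2 h2.2)]
  nlinarith [mul_le_mul_of_nonneg_right h3 hB.le, mul_le_mul_of_nonneg_left h1 hm.le]

theorem eq_pole (h : IsElliptic β M σ τ B m) {q : ellipsoid (M ^ 2)}
    (hq : poleEnergy σ τ B m q = 0) : q = pole M := by
  have := h.dist_pole_sq_le q
  rw [hq, mul_zero] at this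
  exact dist_le_zero.1 (by nlinarith [dist_nonneg (x := q) (y := pole M)])

theorem exists_sublevel_subset (h : IsElliptic β M σ τ B m) {U : Set (ellipsoid (M ^ 2))}
    (hU : U ∈ 𝓝 (pole M)) : ∃ δ > 0, ∀ q : ellipsoid (M ^ 2), poleEnergy σ τ B m q < δ → q ∈ U := by
  obtain ⟨e, he, hball⟩ := Metric.mem_nhds_iff.1 hU
  have hc : 0 < 2 * m / (B - m) := div_pos (by linarith [h.pos]) (by linarith [h.lt])
  refine ⟨e ^ 2 / (2 * m / (B - m)), by positivity, fun q hq => hball ?_⟩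
  rw [lt_div_iff₀ hc] at hq
  exact lt_of_pow_lt_pow_left₀ 2 he.le (by linarith [h.dist_pole_sq_le q])

variable {φ : ℝ → ellipsoid (M ^ 2) → ellipsoid (M ^ 2)}

/-- Because `τ² = 1`, the energy is `2 B m - σ τ ((x² - y²) / 2 + 2 β z)`. The bracket is a first
integral: its two terms have derivatives `2 β x y` and `-2 β x y`. -/
theorem poleEnergy_flow (h : IsElliptic β M σ τ B m) (hφ : IsLeafFlow β φ)
    (t : ℝ) (q : ellipsoid (M ^ 2)) : poleEnergy σ τ B m (φ t q) = poleEnergy σ τ B m q := by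
  have hd : ∀ t, HasDerivAt (fun t => poleEnergy σ τ B m (φ t q)) 0 t := fun t => by
    refine (((((hφ.hasDerivAt_two q t).const_mul σ).const_sub m).const_mul (2 * B)).sub
      (((((hφ.hasDerivAt_zero q t).pow 2).sub ((hφ.hasDerivAt_one q t).pow 2)).const_mul
        (σ * τ)).div_const 2)).congr_deriv ?_
    rw [h.eq_β]
    simp
    linear_combination (-2 * B * σ * (φ t q : E3) 0 * (φ t q : E3) 1) * h.sq_τ
  have := is_const_of_deriv_eq_zero (fun s => (hd s).differentiableAt) (fun s => (hd s).deriv) t 0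
  simpa only [hφ.map_zero] using this

theorem isLyapunovStable (h : IsElliptic β M σ τ B m) (hφ : IsLeafFlow β φ) :
    IsLyapunovStable φ (pole M) := by
  intro U hU hp
  obtain ⟨δ, hδ, hsub⟩ := h.exists_sublevel_subset (hU.mem_nhds hp)
  refine ⟨{q | poleEnergy σ τ B m q < δ}, hsub,
    isOpen_lt (continuous_poleEnergy _ _ _ _ _) continuous_const, ?_, fun q hq t _ => hsub _ ?_⟩
  · rw [mem_ofPred_eq, h.poleEnergy_pole]
    exact hδ
  · rw [h.poleEnergy_flow hφ]
    exact hq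

/-- A point of low energy is determined by its energy and the direction of its projection to the
`(x, y)`-plane. -/
theorem eq_of_poleEnergy_eq (h : IsElliptic β M σ τ B m) {q q' : ellipsoid (M ^ 2)}
    (hq : poleEnergy σ τ B m q < m * (2 * B - m))
    (he : poleEnergy σ τ B m q' = poleEnergy σ τ B m q) {c : ℝ} (hc : 0 < c)
    (h0 : (q' : E3) 0 = c * (q : E3) 0) (h1 : (q' : E3) 1 = c * (q : E3) 1) : q' = q := by
  -- With `q'` the outer point we get `Z' ≤ Z`. Equal energies give `2B (Z - Z') ≤ (Z - Z') (Z +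
  -- Z')`, and `Z + Z' ≤ 2m < 2B` then forces `Z = Z'`.
  wlog hc1 : 1 ≤ c generalizing q q' c
  · refine (this (q := q') (q' := q) (c := c⁻¹) (he ▸ hq) he.symm (inv_pos.2 hc) ?_ ?_ ?_).symm
    · rw [h0]; field_simp
    · rw [h1]; field_simp
    · exact (one_le_inv₀ hc).2 (le_of_not_ge hc1)
  have hZ := h.height_pos hq
  have hZ' := h.height_pos (he ▸ hq)
  have e := h.ellipsoid_eq' q
  have e' := h.ellipsoid_eq' q'
  have hle := (abs_le.1 (h.abs_height_le q)).2
  have hle' := (abs_le.1 (h.abs_height_le q')).2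
  have hw : 0 ≤ m ^ 2 - (σ * (q : E3) 2) ^ 2 := by nlinarith [h.pos]
  have hcc : 0 ≤ c ^ 2 - 1 := by nlinarith
  rw [h0, h1] at e'
  have hww : m ^ 2 - (σ * (q' : E3) 2) ^ 2 = c ^ 2 * (m ^ 2 - (σ * (q : E3) 2) ^ 2) := by
    linear_combination (-1 / 2) * e' + c ^ 2 / 2 * e
  have hzz : σ * (q' : E3) 2 ≤ σ * (q : E3) 2 := by
    refine le_of_sq_le_sq ?_ hZ.le
    nlinarith [mul_nonneg hcc hw]
  have key : 2 * B * (σ * (q : E3) 2 - σ * (q' : E3) 2) ≤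
      (σ * (q : E3) 2 - σ * (q' : E3) 2) * (σ * (q : E3) 2 + σ * (q' : E3) 2) := by
    unfold poleEnergy at he
    rw [h0, h1] at he
    have hx := mul_nonneg hcc (sq_nonneg ((q : E3) 0))
    have hy := mul_nonneg hcc (sq_nonneg ((q : E3) 1))
    have hxy : (c ^ 2 - 1) * ((q : E3) 0 ^ 2 + (q : E3) 1 ^ 2) =
        2 * ((σ * (q : E3) 2) ^ 2 - (σ * (q' : E3) 2) ^ 2) := by
      linear_combination e' - e
    rcases h.sign_mul_sign with hs | hs <;> rw [hs] at he <;> nlinarith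
  have hz : σ * (q' : E3) 2 = σ * (q : E3) 2 := by
    by_contra hne
    have : 0 < σ * (q : E3) 2 - σ * (q' : E3) 2 := sub_pos.2 (lt_of_le_of_ne hzz hne)
    have h3 := mul_pos this (by linarith [h.lt] :
      0 < 2 * B - (σ * (q : E3) 2 + σ * (q' : E3) 2))
    linarith
  have hσ : σ ≠ 0 := fun h0 => by simpa [h0] using h.sq_σ
  rw [hz] at hww
  have hprod : (c ^ 2 - 1) * ((q : E3) 0 ^ 2 + (q : E3) 1 ^ 2) = 0 := by
    rw [e]
    linear_combination -2 * hww
  have hxy : (q' : E3) 0 = (q : E3) 0 ∧ (q' : E3) 1 = (q : E3) 1 := by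
    rcases mul_eq_zero.1 hprod with hc2 | h2
    · have : c = 1 := le_antisymm (by nlinarith) hc1
      rw [h0, h1, this, one_mul, one_mul]
      exact ⟨rfl, rfl⟩
    · have hx : (q : E3) 0 = 0 := pow_eq_zero_iff two_ne_zero |>.1
        (by linarith [sq_nonneg ((q : E3) 0), sq_nonneg ((q : E3) 1)])
      have hy : (q : E3) 1 = 0 := pow_eq_zero_iff two_ne_zero |>.1
        (by linarith [sq_nonneg ((q : E3) 0), sq_nonneg ((q : E3) 1)])
      rw [h0, h1, hx, hy, mul_zero]
      exact ⟨rfl, rfl⟩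
  refine Subtype.ext ?_
  ext i
  fin_cases i
  · exact hxy.1
  · exact hxy.2
  · exact mul_left_cancel₀ hσ hz

end IsElliptic

/-! ### Rotation around the pole and the periods -/

/-- The projection to the `(x, y)`-plane, scaled and oriented such that the linearized flow at the
pole becomes a rotation in the positive sense. -/
noncomputable def scaledProjection (σ τ B m : ℝ) (q : E3) : ℂ :=
  ((√(B - σ * τ * m) * q 0 : ℝ) : ℂ) + ((-(τ * √(B + σ * τ * m) * q 1) : ℝ) : ℂ) * Complex.I

namespace IsElliptic

variable {β M σ τ B m : ℝ} {φ : ℝ → ellipsoid (M ^ 2) → ellipsoid (M ^ 2)}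

theorem le_sub (h : IsElliptic β M σ τ B m) : B - m ≤ B - σ * τ * m := by
  rcases h.sign_mul_sign with hs | hs <;> rw [hs] <;> linarith [h.pos]

theorem le_add (h : IsElliptic β M σ τ B m) : B - m ≤ B + σ * τ * m := by
  rcases h.sign_mul_sign with hs | hs <;> rw [hs] <;> linarith [h.pos]

theorem sub_pos' (h : IsElliptic β M σ τ B m) : 0 < B - σ * τ * m :=
  (sub_pos.2 h.lt).trans_le h.le_sub

theorem add_pos' (h : IsElliptic β M σ τ B m) : 0 < B + σ * τ * m :=
  (sub_pos.2 h.lt).trans_le h.le_add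

theorem τ_ne_zero (h : IsElliptic β M σ τ B m) : τ ≠ 0 :=
  fun h0 => by simpa [h0] using h.sq_τ

theorem sqrt_mul_sqrt (h : IsElliptic β M σ τ B m) :
    √(B - σ * τ * m) * √(B + σ * τ * m) = √(β ^ 2 - M ^ 2) := by
  rw [← Real.sqrt_mul h.sub_pos'.le, h.sq_M, h.eq_β]
  congr 1
  linear_combination (-m ^ 2 * τ ^ 2) * h.sq_σ + (-m ^ 2 - B ^ 2) * h.sq_τ

theorem frequency_pos (h : IsElliptic β M σ τ B m) : 0 < √(β ^ 2 - M ^ 2) := by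
  rw [← h.sqrt_mul_sqrt]
  exact mul_pos (Real.sqrt_pos.2 h.sub_pos') (Real.sqrt_pos.2 h.add_pos')

/-- Only the two poles project to `0`: positive energy excludes this one, low energy the opposite
one. -/
theorem scaledProjection_ne_zero (h : IsElliptic β M σ τ B m) {q : ellipsoid (M ^ 2)}
    (h0 : 0 < poleEnergy σ τ B m q) (h1 : poleEnergy σ τ B m q < m * (2 * B - m)) :
    scaledProjection σ τ B m q ≠ 0 := by
  intro hq
  have hre := congrArg Complex.re hq
  have him := congrArg Complex.im hq
  have hd := Real.sqrt_pos.2 h.sub_pos'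
  have hs := Real.sqrt_pos.2 h.add_pos'
  simp [scaledProjection, hd.ne'] at hre
  simp [scaledProjection, hs.ne', h.τ_ne_zero] at him
  have hz := h.height_pos h1
  have he := h.ellipsoid_eq' q
  rw [hre, him] at he
  have hZ : σ * (q : E3) 2 = m := by
    have h2 : (m - σ * (q : E3) 2) * (m + σ * (q : E3) 2) = 0 := by linarith
    rcases mul_eq_zero.1 h2 with h3 | h3
    · linarith
    · linarith [h.pos]
  simp [poleEnergy, hre, him, hZ] at h0

theorem eq_of_scaledProjection (h : IsElliptic β M σ τ B m) {q q' : ellipsoid (M ^ 2)}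
    (hq : poleEnergy σ τ B m q < m * (2 * B - m))
    (he : poleEnergy σ τ B m q' = poleEnergy σ τ B m q) {R R' : ℝ} {u : ℂ} (hR : 0 < R)
    (hR' : 0 < R') (h0 : scaledProjection σ τ B m q = R * u)
    (h1 : scaledProjection σ τ B m q' = R' * u) : q' = q := by
  have hd := Real.sqrt_pos.2 h.sub_pos'
  have hs := Real.sqrt_pos.2 h.add_pos'
  have e : scaledProjection σ τ B m q' = ((R' / R : ℝ) : ℂ) * scaledProjection σ τ B m q := by
    rw [h0, h1]
    push_cast
    have : (R : ℂ) ≠ 0 := by exact_mod_cast hR.ne'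
    field_simp
  have hre := congrArg Complex.re e
  have him := congrArg Complex.im e
  rw [Complex.re_ofReal_mul] at hre
  rw [Complex.im_ofReal_mul] at him
  simp only [scaledProjection, Complex.add_re, Complex.add_im, Complex.ofReal_re,
    Complex.ofReal_im, Complex.mul_re, Complex.mul_im, Complex.I_re, Complex.I_im] at hre him
  refine h.eq_of_poleEnergy_eq hq he (div_pos hR' hR) ?_ ?_
  · refine mul_left_cancel₀ hd.ne' ?_
    linear_combination hre
  · refine mul_left_cancel₀ (mul_ne_zero h.τ_ne_zero hs.ne') ?_
    linear_combination -him

theorem hasDerivAt_scaledProjection (hφ : IsLeafFlow β φ) (q : ellipsoid (M ^ 2)) (t : ℝ) :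
    HasDerivAt (fun t => scaledProjection σ τ B m (φ t q))
      (scaledProjection σ τ B m (rikitake β (φ t q))) t := by
  have hx := ((hφ.hasDerivAt_zero q t).const_mul √(B - σ * τ * m)).ofReal_comp
  have hy := ((hφ.hasDerivAt_one q t).const_mul (τ * √(B + σ * τ * m))).neg.ofReal_comp
  exact HasDerivAt.congr_deriv (hx.add (hy.mul_const Complex.I))
    (by simp [scaledProjection, rikitake])

theorem continuous_scaledProjection : Continuous (scaledProjection σ τ B m) := by
  unfold scaledProjection
  fun_prop

/-- The angular velocity is `ω` times the quotient of `(B - στZ) x² + (B + στZ) y²` by the same form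
with `m` in place of `Z`. Corresponding coefficients differ by `m - Z`, at most `δ` times those of
the denominator. -/
theorem angularVelocity_mem (h : IsElliptic β M σ τ B m) {q : ellipsoid (M ^ 2)}
    (h0 : scaledProjection σ τ B m q ≠ 0) {δ : ℝ} (hδ : m - σ * (q : E3) 2 ≤ δ * (B - m)) :
    (scaledProjection σ τ B m (rikitake β q) / scaledProjection σ τ B m q).im ∈
      Icc (√(β ^ 2 - M ^ 2) * (1 - δ)) (√(β ^ 2 - M ^ 2) * (1 + δ)) := by
  have hN : 0 < Complex.normSq (scaledProjection σ τ B m q) := Complex.normSq_pos.2 h0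
  have hd2 := Real.sq_sqrt h.sub_pos'.le
  have hs2 := Real.sq_sqrt h.add_pos'.le
  have hω := h.frequency_pos
  have hNeq : Complex.normSq (scaledProjection σ τ B m q) =
      (B - σ * τ * m) * (q : E3) 0 ^ 2 + (B + σ * τ * m) * (q : E3) 1 ^ 2 := by
    simp [scaledProjection, Complex.normSq_apply]
    linear_combination (q : E3) 0 ^ 2 * hd2 + τ ^ 2 * (q : E3) 1 ^ 2 * hs2 +
      (B + σ * τ * m) * (q : E3) 1 ^ 2 * h.sq_τ
  have him : (scaledProjection σ τ B m (rikitake β q) / scaledProjection σ τ B m q).im =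
      √(β ^ 2 - M ^ 2) * (((B - σ * τ * (σ * (q : E3) 2)) * (q : E3) 0 ^ 2 +
        (B + σ * τ * (σ * (q : E3) 2)) * (q : E3) 1 ^ 2) /
        Complex.normSq (scaledProjection σ τ B m q)) := by
    rw [Complex.div_im, ← h.sqrt_mul_sqrt, ← sub_div, ← mul_div_assoc]
    congr 1
    simp [scaledProjection, rikitake, h.eq_β]
    set d := √(B - σ * τ * m)
    set s := √(B + σ * τ * m)
    set z := (q : E3) 2
    linear_combination (d * s * B * ((q : E3) 0 ^ 2 + (q : E3) 1 ^ 2)) * h.sq_τ +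
      (d * s * τ * z * ((q : E3) 0 ^ 2 - (q : E3) 1 ^ 2)) * h.sq_σ
  have hU := (abs_le.1 (h.abs_height_le q)).2
  have hD : m - σ * (q : E3) 2 ≤ δ * (B - σ * τ * m) := by
    have : 0 ≤ δ := by
      by_contra! hneg
      nlinarith [h.lt]
    exact hδ.trans (mul_le_mul_of_nonneg_left h.le_sub this)
  have hA : m - σ * (q : E3) 2 ≤ δ * (B + σ * τ * m) := by
    have : 0 ≤ δ := by
      by_contra! hneg
      nlinarith [h.lt]
    exact hδ.trans (mul_le_mul_of_nonneg_left h.le_add this)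
  have hx := sq_nonneg ((q : E3) 0)
  have hy := sq_nonneg ((q : E3) 1)
  have e1 := mul_nonneg (sub_nonneg.2 hD) hx
  have e2 := mul_nonneg (sub_nonneg.2 hA) hy
  have e3 := mul_nonneg (sub_nonneg.2 hU) hx
  have e4 := mul_nonneg (sub_nonneg.2 hU) hy
  rw [him]
  refine ⟨mul_le_mul_of_nonneg_left ?_ hω.le, mul_le_mul_of_nonneg_left ?_ hω.le⟩
  · rw [le_div_iff₀ hN, hNeq]
    rcases h.sign_mul_sign with hs | hs <;> rw [hs] at e1 e2 ⊢ <;> linarith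
  · rw [div_le_iff₀ hN, hNeq]
    rcases h.sign_mul_sign with hs | hs <;> rw [hs] at e1 e2 ⊢ <;> linarith

/-- Orbits of low energy are periodic energy levels, with a period close to that of the linearized
flow. -/
theorem exists_period (h : IsElliptic β M σ τ B m) (hφ : IsLeafFlow β φ) {q : ellipsoid (M ^ 2)}
    (h0 : 0 < poleEnergy σ τ B m q) (h1 : poleEnergy σ τ B m q < m * (2 * B - m)) {δ : ℝ}
    (hδ : poleEnergy σ τ B m q = 2 * (B - m) ^ 2 * δ) (hδ1 : δ < 1) :
    leafOrbit φ q = {q' : ellipsoid (M ^ 2) | poleEnergy σ τ B m q' = poleEnergy σ τ B m q} ∧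
    ∃ T, IsOrbitPeriod φ q T ∧ 2 * Real.pi / (√(β ^ 2 - M ^ 2) * (1 + δ)) ≤ T ∧
      T ≤ 2 * Real.pi / (√(β ^ 2 - M ^ 2) * (1 - δ)) := by
  have hBm : 0 < B - m := sub_pos.2 h.lt
  have hδ0 : 0 < δ := by
    by_contra! hneg
    nlinarith [mul_nonneg (sq_nonneg (B - m)) (neg_nonneg.2 hneg)]
  have hω := h.frequency_pos
  have hE := fun t => h.poleEnergy_flow hφ t q
  have hne : ∀ t, scaledProjection σ τ B m (φ t q) ≠ 0 := fun t =>
    h.scaledProjection_ne_zero (by rwa [hE]) (by rwa [hE])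
  -- The normalization of `δ` is chosen so that the conserved energy yields this bound along the
  -- whole orbit.
  have hdepth : ∀ t, m - σ * (φ t q : E3) 2 ≤ δ * (B - m) := fun t => by
    have := h.depth_le_poleEnergy (φ t q)
    rw [hE, hδ] at this
    have h2 : 2 * (B - m) * (m - σ * (φ t q : E3) 2) ≤ 2 * (B - m) * (δ * (B - m)) := by linarith
    exact le_of_mul_le_mul_left h2 (by linarith)
  have hcont : Continuous fun t => scaledProjection σ τ B m (rikitake β (φ t q)) :=
    continuous_scaledProjection.comp ((contDiff_rikitake β).continuous.comp
      (continuous_subtype_val.comp (hφ.continuous_orbit q)))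
  obtain ⟨R, θ, hR, hpolar, hθ⟩ := exists_angle_lift (hasDerivAt_scaledProjection hφ q) hcont hne
  obtain ⟨hmono, hsurj, hbound⟩ := bijective_of_deriv_mem_Icc (mul_pos hω (sub_pos.2 hδ1)) hθ
    fun t => h.angularVelocity_mem (hne t) (hdepth t)
  constructor
  · ext q'
    constructor
    · rintro ⟨t, rfl⟩
      exact hE t
    · intro hq'
      have hq'' : poleEnergy σ τ B m q' = poleEnergy σ τ B m q := hq'
      have hne' := h.scaledProjection_ne_zero (by rwa [hq'']) (by rwa [hq''])
      -- The orbit passes through every direction, and energy and direction determine the point.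
      obtain ⟨t, ht⟩ := hsurj (scaledProjection σ τ B m q').arg
      refine ⟨t, (h.eq_of_scaledProjection (by rwa [hE]) (by rw [hE, hq'']) (hR t)
        (norm_pos_iff.2 hne') (hpolar t) ?_).symm⟩
      rw [ht, Complex.norm_mul_exp_arg_mul_I]
  · obtain ⟨T, hT⟩ := hsurj (θ 0 + 2 * Real.pi)
    have hT0 : 0 < T := hmono.lt_iff_lt.1 (by rw [hT]; linarith [Real.pi_pos])
    have hb := hbound 0 T hT0.le
    rw [hT, sub_zero, add_sub_cancel_left] at hb
    have hp0 := hpolar 0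
    rw [hφ.map_zero] at hp0
    refine ⟨T, ⟨⟨hT0, ?_⟩, fun t ⟨ht0, ht⟩ => ?_⟩, ?_, ?_⟩
    · refine h.eq_of_scaledProjection h1 (hE T) (hR 0) (hR T) hp0 ?_
      rw [hpolar T, hT]
      congr 1
      rw [Complex.exp_eq_exp_iff_exists_int]
      exact ⟨1, by push_cast; ring⟩
    · have hpt := hpolar t
      rw [ht, hp0] at hpt
      have hRt : R 0 = R t := by
        have := congrArg norm hpt
        simpa [Complex.norm_exp_ofReal_mul_I, abs_of_pos (hR _)] using this
      have hRt0 : (R t : ℂ) ≠ 0 := by exact_mod_cast (hR t).ne'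
      rw [hRt] at hpt
      -- A return changes the angle by `2πn`. As the angle increases, a positive time gives `n ≥ 1`,
      -- so no return precedes `T`.
      obtain ⟨n, hn⟩ := Complex.exp_eq_exp_iff_exists_int.1 (mul_left_cancel₀ hRt0 hpt).symm
      have hn' : θ t = θ 0 + n * (2 * Real.pi) := by
        have := congrArg Complex.im hn
        simpa using this
      have hlt := hmono ht0
      have hn0 : (0 : ℝ) < n := by
        have : 0 < (n : ℝ) * (2 * Real.pi) := by linarith
        exact pos_of_mul_pos_left this (by positivity)
      have hn1 : (1 : ℝ) ≤ n := by exact_mod_cast (by exact_mod_cast hn0 : (0 : ℤ) < n)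
      refine hmono.le_iff_le.1 ?_
      rw [hT, hn']
      nlinarith [Real.pi_pos]
    · rw [div_le_iff₀ (by positivity)]
      linarith [hb.2]
    · rw [le_div_iff₀ (mul_pos hω (sub_pos.2 hδ1))]
      linarith [hb.1]

end IsElliptic

/-! ### The family of periodic orbits and the component they fill -/

namespace IsElliptic

variable {β M σ τ B m : ℝ} {φ : ℝ → ellipsoid (M ^ 2) → ellipsoid (M ^ 2)}

theorem poleEnergy_meridian (h : IsElliptic β M σ τ B m) (t : ℝ) :
    poleEnergy σ τ B m (meridian M (c := 1) (s := 0) (by norm_num) t) =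
      m * (1 - Real.cos t) * (2 * (B - σ * τ * m) + σ * τ * m * (1 - Real.cos t)) := by
  have h2 : √2 ^ 2 = (2 : ℝ) := Real.sq_sqrt (by norm_num)
  have h3 := Real.sin_sq_add_cos_sq t
  simp only [poleEnergy, meridian]
  simp
  linear_combination (-2 * B * σ * Real.cos t) * h.eq_M - (2 * B * m * Real.cos t) * h.sq_σ -
    σ * τ * M ^ 2 * Real.sin t ^ 2 / 2 * h2 - σ * τ * M ^ 2 * h3 -
    σ * τ * (1 - Real.cos t ^ 2) * h.sq_M

/-- In terms of `u = m (1 - cos t)`, increasing up to `π`, the energy is `u (2 (B - στm) + στu)`.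
This is increasing in `u` as long as `u < B - στm`. -/
theorem strictMonoOn_poleEnergy_meridian (h : IsElliptic β M σ τ B m) {a : ℝ} (ha : a ≤ Real.pi)
    (ha' : ∀ t ∈ Icc 0 a, m * (1 - Real.cos t) < B - σ * τ * m) :
    StrictMonoOn (fun t => poleEnergy σ τ B m (meridian M (c := 1) (s := 0) (by norm_num) t))
      (Icc 0 a) := by
  intro s hs t ht hst
  have hcos : Real.cos t < Real.cos s :=
    Real.strictAntiOn_cos ⟨hs.1, hs.2.trans ha⟩ ⟨ht.1, ht.2.trans ha⟩ hst
  have h1 := ha' s hs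
  have h2 := ha' t ht
  have h1' := mul_nonneg h.pos.le (sub_nonneg.2 (Real.cos_le_one s))
  have h2' := mul_nonneg h.pos.le (sub_nonneg.2 (Real.cos_le_one t))
  have hpos : 0 < 2 * (B - σ * τ * m) + σ * τ * (m * (1 - Real.cos s) + m * (1 - Real.cos t)) := by
    rcases h.sign_mul_sign with hs | hs <;> rw [hs] at h1 h2 ⊢ <;> linarith
  have := mul_pos (mul_pos h.pos (sub_pos.2 hcos)) hpos
  simp only [h.poleEnergy_meridian]
  linarith

/-- Near the pole the ellipsoid is filled by periodic orbits. -/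
theorem exists_periodic_family (h : IsElliptic β M σ τ B m) (hφ : IsLeafFlow β φ) :
    ∃ ε₀ : ℝ, 0 < ε₀ ∧ ∃ (x : ℝ → ellipsoid (M ^ 2)) (T : ℝ → ℝ),
      ContinuousOn x (Ioc 0 ε₀) ∧
      InjOn (fun ε => leafOrbit φ (x ε)) (Ioc 0 ε₀) ∧
      (∀ ε ∈ Ioc 0 ε₀, IsOrbitPeriod φ (x ε) (T ε) ∧
        IsIntegralCurve (fun t => (φ t (x ε) : E3)) (fun _ => rikitake β)) ∧
      (∀ U ∈ 𝓝 (pole M), ∀ᶠ ε in 𝓝[>] 0, leafOrbit φ (x ε) ⊆ U) ∧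
      Tendsto T (𝓝[>] 0) (𝓝 (2 * Real.pi / √(β ^ 2 - M ^ 2))) ∧
      ({pole M} ∪ ⋃ ε ∈ Ioo 0 ε₀, leafOrbit φ (x ε)) =
        connectedComponentIn (leafOrbit φ (x ε₀))ᶜ (pole M) := by
  set x : ℝ → ellipsoid (M ^ 2) := meridian M (c := 1) (s := 0) (by norm_num) with hx
  set E : ellipsoid (M ^ 2) → ℝ := fun q => poleEnergy σ τ B m q with hE
  have hEc : Continuous E := continuous_poleEnergy _ _ _ _ _
  have hxc : Continuous x := continuous_meridian M _
  have hx0 : x 0 = pole M := meridian_zero M _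
  have hE0 : E (x 0) = 0 := by rw [hx0]; exact h.poleEnergy_pole
  have hBm : 0 < B - m := sub_pos.2 h.lt
  have hω := h.frequency_pos
  have hflow : ∀ t q, E (φ t q) = E q := h.poleEnergy_flow hφ
  set δ : ℝ → ℝ := fun ε => E (x ε) / (2 * (B - m) ^ 2) with hδ
  have hδc : Continuous δ := (hEc.comp hxc).div_const _
  have hδ0 : δ 0 = 0 := by simp only [hδ, hE0, zero_div]
  -- The first and last conditions make the energy monotone along the meridian; the middle two are
  -- what `exists_period` needs.
  have hev : ∀ᶠ ε in 𝓝 (0 : ℝ), m * (1 - Real.cos ε) < B - σ * τ * m ∧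
      E (x ε) < m * (2 * B - m) ∧ δ ε < 1 ∧ ε < Real.pi := by
    have hc1 : Continuous fun ε : ℝ => m * (1 - Real.cos ε) := by fun_prop
    refine (hc1.continuousAt.eventually_lt continuousAt_const ?_).and
      (((hEc.comp hxc).continuousAt.eventually_lt continuousAt_const ?_).and
      ((hδc.continuousAt.eventually_lt continuousAt_const ?_).and
      (eventually_lt_nhds Real.pi_pos)))
    · simpa using h.sub_pos'
    · rw [Function.comp_apply, hE0]
      exact mul_pos h.pos (by linarith [h.pos, h.lt])
    · rw [hδ0]
      exact one_pos
  obtain ⟨e, he, hball⟩ := Metric.eventually_nhds_iff.1 hev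
  obtain ⟨ε₀, hε₀, hε₀e⟩ := exists_between he
  have hcond : ∀ ε ∈ Icc 0 ε₀, m * (1 - Real.cos ε) < B - σ * τ * m ∧
      E (x ε) < m * (2 * B - m) ∧ δ ε < 1 ∧ ε < Real.pi := fun ε hε =>
    hball (by rw [Real.dist_0_eq_abs, abs_of_nonneg hε.1]; linarith [hε.2])
  have hmono : StrictMonoOn (fun ε => E (x ε)) (Icc 0 ε₀) :=
    h.strictMonoOn_poleEnergy_meridian (hcond ε₀ (right_mem_Icc.2 hε₀.le)).2.2.2.le
      fun t ht => (hcond t ht).1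
  have hpos : ∀ ε ∈ Ioc 0 ε₀, 0 < E (x ε) := fun ε hε => by
    have := hmono (left_mem_Icc.2 hε₀.le) (Ioc_subset_Icc_self hε) hε.1
    simpa only [hE0] using this
  have hper := fun ε (hε : ε ∈ Ioc 0 ε₀) =>
    h.exists_period hφ (hpos ε hε) (hcond ε (Ioc_subset_Icc_self hε)).2.1 (δ := δ ε)
      (by simp only [hδ, hE]; field_simp) (hcond ε (Ioc_subset_Icc_self hε)).2.2.1
  have horb : ∀ ε ∈ Ioc 0 ε₀, leafOrbit φ (x ε) = {q | E q = E (x ε)} := fun ε hε => (hper ε hε).1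
  have hT' := fun ε (hε : ε ∈ Ioc 0 ε₀) => (hper ε hε).2
  choose! T hT using hT'
  have hmem : Ioc 0 ε₀ ∈ 𝓝[>] (0 : ℝ) := Ioc_mem_nhdsGT hε₀
  refine ⟨ε₀, hε₀, x, T, hxc.continuousOn, ?_, fun ε hε => ⟨(hT ε hε).1, hφ.hasDerivAt _⟩, ?_, ?_, ?_⟩
  · intro ε hε ε' hε' heq
    simp only [horb ε hε, horb ε' hε'] at heq
    have : x ε ∈ {q | E q = E (x ε')} := heq ▸ (rfl : E (x ε) = E (x ε))
    exact hmono.injOn (Ioc_subset_Icc_self hε) (Ioc_subset_Icc_self hε') this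
  · intro U hU
    obtain ⟨d, hd, hsub⟩ := h.exists_sublevel_subset hU
    have hsmall : ∀ᶠ ε in 𝓝 (0 : ℝ), E (x ε) < d :=
      (hEc.comp hxc).continuousAt.eventually_lt continuousAt_const
        (by rw [Function.comp_apply, hE0]; exact hd)
    filter_upwards [nhdsWithin_le_nhds hsmall] with ε hε
    rintro _ ⟨t, rfl⟩
    exact hsub _ (by rw [h.poleEnergy_flow hφ]; exact hε)
  · have hlim : ∀ s : ℝ, Tendsto (fun ε => 2 * Real.pi / (√(β ^ 2 - M ^ 2) * (1 + s * δ ε)))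
        (𝓝[>] 0) (𝓝 (2 * Real.pi / √(β ^ 2 - M ^ 2))) := fun s => by
      have hc : ContinuousAt (fun ε => 2 * Real.pi / (√(β ^ 2 - M ^ 2) * (1 + s * δ ε))) 0 := by
        refine continuousAt_const.div ?_ ?_
        · exact (continuous_const.mul
            (continuous_const.add (continuous_const.mul hδc))).continuousAt
        · rw [hδ0, mul_zero, add_zero, mul_one]
          exact hω.ne'
      have := hc.tendsto
      rw [hδ0, mul_zero, add_zero, mul_one] at this
      exact this.mono_left nhdsWithin_le_nhds
    refine tendsto_of_tendsto_of_tendsto_of_le_of_le' (hlim 1) (hlim (-1)) ?_ ?_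
    · filter_upwards [hmem] with ε hε
      rw [one_mul]
      exact (hT ε hε).2.1
    · filter_upwards [hmem] with ε hε
      rw [neg_one_mul, ← sub_eq_add_neg]
      exact (hT ε hε).2.2
  · have hright : ε₀ ∈ Ioc 0 ε₀ := right_mem_Ioc.2 hε₀
    have hsub : ∀ q : ellipsoid (M ^ 2), E q < E (x ε₀) → E q ≠ 0 →
        ∃ ε ∈ Ioo 0 ε₀, q ∈ leafOrbit φ (x ε) := fun q hq hq0 => by
      have hq1 : 0 < E q := lt_of_le_of_ne (h.poleEnergy_nonneg q) (Ne.symm hq0)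
      obtain ⟨ε, hε, hEε⟩ := intermediate_value_Ioo hε₀.le (f := fun ε => E (x ε))
        (hEc.comp hxc).continuousOn (show E q ∈ Ioo _ _ from ⟨by rwa [hE0], hq⟩)
      refine ⟨ε, hε, ?_⟩
      rw [horb ε (Ioo_subset_Ioc_self hε)]
      exact hEε.symm
    have hlt : ∀ ε ∈ Ico 0 ε₀, E (x ε) < E (x ε₀) := fun ε hε =>
      hmono (Ico_subset_Icc_self hε) (right_mem_Icc.2 hε₀.le) hε.2
    have hpole : E (pole M) < E (x ε₀) := by
      rw [← hx0]
      exact hlt 0 (left_mem_Ico.2 hε₀)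
    have hS : ({pole M} ∪ ⋃ ε ∈ Ioo 0 ε₀, leafOrbit φ (x ε)) = {q | E q < E (x ε₀)} := by
      ext q
      simp only [mem_union, mem_singleton_iff, mem_iUnion, exists_prop, mem_ofPred_eq]
      constructor
      · rintro (rfl | ⟨ε, hε, t, rfl⟩)
        · exact hpole
        · beta_reduce
          rw [hflow]
          exact hlt ε (Ioo_subset_Ico_self hε)
      · intro hq
        by_cases hq0 : E q = 0
        · exact Or.inl (h.eq_pole hq0)
        · exact Or.inr (hsub q hq hq0)
    -- A point is joined to the pole by following its orbit to the meridian and then the meridian.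
    have hconn : IsPreconnected {q | E q < E (x ε₀)} := by
      refine isPreconnected_of_forall (pole M) fun q hq => ?_
      by_cases hq0 : E q = 0
      · rw [h.eq_pole hq0]
        exact ⟨{pole M}, singleton_subset_iff.2 hpole, rfl, rfl, isPreconnected_singleton⟩
      · obtain ⟨ε, hε, hqε⟩ := hsub q hq hq0
        refine ⟨x '' Icc 0 ε ∪ leafOrbit φ (x ε), ?_, Or.inl ⟨0, left_mem_Icc.2 hε.1.le, hx0⟩,
          Or.inr hqε, ?_⟩
        · rintro _ (⟨s, hs, rfl⟩ | ⟨t, rfl⟩)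
          · exact hlt s ⟨hs.1, hs.2.trans_lt hε.2⟩
          · rw [mem_ofPred_eq, hflow]
            exact hlt ε (Ioo_subset_Ico_self hε)
        · exact IsPreconnected.union (x ε) ⟨ε, right_mem_Icc.2 hε.1.le, rfl⟩ ⟨0, hφ.map_zero _⟩
            (isPreconnected_Icc.image x hxc.continuousOn)
            (isPreconnected_range (hφ.continuous_orbit _))
    have hpc : pole M ∈ (leafOrbit φ (x ε₀))ᶜ := by
      rw [horb ε₀ hright]
      exact hpole.ne
    rw [hS]
    refine (hconn.subset_connectedComponentIn hpole ?_).antisymm ?_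
    · rw [horb ε₀ hright]
      exact fun q hq => ne_of_lt hq
    -- Off the level set the ellipsoid splits into the disjoint open sets of lower and higher
    -- energy, and the pole lies in the lower one.
    · refine isPreconnected_connectedComponentIn.subset_left_of_subset_union
        (isOpen_lt hEc continuous_const) (isOpen_lt (continuous_const (y := E (x ε₀))) hEc) ?_ ?_
        ⟨pole M, mem_connectedComponentIn hpc, hpole⟩
      · exact Set.disjoint_left.2 fun q (h1 : E q < E (x ε₀)) h2 => lt_asymm h1 h2
      · refine (connectedComponentIn_subset _ _).trans ?_
        rw [horb ε₀ hright]
        exact fun q hq => lt_or_gt_of_ne hq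

end IsElliptic

/-! ### The equilibrium and the main theorem -/

theorem leafField_pole (β M : ℝ) : leafField β (pole M) = 0 := by
  refine Subtype.ext ?_
  ext i
  fin_cases i <;> simp [leafField, rikitake, pole]

theorem theorem7p2 (β M : ℝ) (hM : M ≠ 0) :
    -- the ellipsoid is the symplectic leaf through the equilibrium
    symplecticLeaf (pole M : E3) = ellipsoid (M ^ 2) ∧
    leafField β (pole M) = 0 ∧
    -- the restricted vector field has a flow, and the assertions hold for its flow
    (∃ φ : ℝ → ellipsoid (M ^ 2) → ellipsoid (M ^ 2), IsLeafFlow β φ) ∧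
    ∀ φ : ℝ → ellipsoid (M ^ 2) → ellipsoid (M ^ 2), IsLeafFlow β φ →
      -- (a) the linearization exists and has the stated characteristic polynomial
      ((∃ L, IsLinearization φ (pole M) L) ∧
        ∀ L, IsLinearization φ (pole M) L →
          L.charpoly = Polynomial.X ^ 2 + Polynomial.C (β ^ 2 - M ^ 2)) ∧
      -- (b)
      (|β| < |M| → ¬ IsLyapunovStable φ (pole M)) ∧
      -- (c)
      (|M| < |β| → IsLyapunovStable φ (pole M)) ∧
      -- (d) the orbits `γ_ε` of the points `x ε`, with periods `T ε`
      (|M| < |β| → ∃ ε₀ : ℝ, 0 < ε₀ ∧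
        ∃ (x : ℝ → ellipsoid (M ^ 2)) (T : ℝ → ℝ),
          ContinuousOn x (Ioc 0 ε₀) ∧
          InjOn (fun ε => leafOrbit φ (x ε)) (Ioc 0 ε₀) ∧
          (∀ ε ∈ Ioc 0 ε₀, IsOrbitPeriod φ (x ε) (T ε) ∧
            IsIntegralCurve (fun t => (φ t (x ε) : E3)) (fun _ => rikitake β)) ∧
          (∀ U ∈ 𝓝 (pole M), ∀ᶠ ε in 𝓝[>] 0, leafOrbit φ (x ε) ⊆ U) ∧
          Tendsto T (𝓝[>] 0) (𝓝 (2 * Real.pi / √(β ^ 2 - M ^ 2))) ∧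
          ({pole M} ∪ ⋃ ε ∈ Ioo 0 ε₀, leafOrbit φ (x ε)) =
            connectedComponentIn (leafOrbit φ (x ε₀))ᶜ (pole M)) := by
  refine ⟨symplecticLeaf_pole hM, leafField_pole β M, exists_isLeafFlow β _, fun φ hφ =>
    ⟨⟨hφ.exists_isLinearization hM, fun L hL => hL.charpoly_eq hM hφ⟩,
      hφ.not_isLyapunovStable, fun h => ?_, fun h => ?_⟩⟩
  · obtain ⟨σ, τ, hE⟩ := exists_isElliptic hM h
    exact hE.isLyapunovStable hφ
  · obtain ⟨σ, τ, hE⟩ := exists_isElliptic hM h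
    exact hE.exists_periodic_family hφ
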